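/- All graphs are finite and simple. Paths are read from left to right; the length of a path is its number of edges. **Layers.** For an integer $l\ge 0$, let $V(G)$ be partitioned into paths (layers) $P_0,\dots,P_l$, two vertices of the same layer being adjacent exactly when they are consecutive on it, and $P_0$ being a single vertex. An *ancestor* of $x\in V(P_i)$ is a neighbour of $x$ in $V(P_0)\cup\dots\cup V(P_{i-1})$; the *type* of $x$ is its number of ancestors. For $i<l$, the path $P_{i+1}$ visits subpaths $\mathrm{Box}_u$ ($u\in V(P_i)$) in the order of the vertices $u$ along $P_i$. **Ttf.** $G$ is an $(l,k)$-*ttf-layered-wheel* if for all $i<l$ and $u\in V(P_i)$: if $u$ has type 0, then the vertices of nonzero type in $\mathrm{Box}_u$ are three vertices whose only ancestor is $u$; if $u$ has exactly one ancestor $v$, they are, in order, three vertices whose only ancestor is $u$, three whose only ancestor is $v$, three whose only ancestor is $u$. The ends of each box have nonzero type, boxes are disjoint, $P_{i+1}$ begins with the first box and ends with the last one, and the vertices of $P_{i+1}$ in no box have type 0. If $w,w'\in V(P_{i+1})$ have nonzero type and all vertices between them on $P_{i+1}$ have type 0, then $wP_{i+1}w'$ has length at least $k-2$. For $uv$ consecutive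 on $P_i$ (in this order), the *$uv$-bridge* is the subpath of $P_{i+1}$ strictly between $\mathrm{Box}_u$ and $\mathrm{Box}_v$. **Ehf.** For a set $A$ of one or two vertices, a zone $E_A$ (resp. $O_A$) is a subpath of $P_{i+1}$ containing exactly four (resp. three) vertices with ancestor set $A$, its ends being among them, and whose other vertices have type 0. $G$ is an $(l,k)$-*ehf-layered-wheel* ($l\ge1$) if for all $i<l$ and $u\in V(P_i)$, $\mathrm{Box}_u$ runs from its first to its last zone, where its zones are, in order (with $u',u''$ the left and right neighbours of $u$ on $P_i$; zones involving a neighbour that does not exist are omitted): $E_{u'u},O_u,E_{uu''}$ if $u$ has type 0; $E_{u'u},O_u,O_{uv},O_u,E_{uu''}$ if $u$ has exactly one ancestor $v$; and $E_{u'u},E_u,E_{vw},O_u,O_{uv},O_u,O_{uw},O_u,E_{vw},E_u,E_{uu''}$ if $u$ has exactly two ancestors $v,w$, listed so that $v$ lies in a later layer than $w$ or $v,w$ lie in the same layer in this order. Distinct zones are disjoint; boxes of consecutive vertices $u,v$ share precisely the zone $E_{uv}$, which is the *$uv$-bridge*, and other pairs of boxes are disjoint. The boxes cover $P_{i+1}$,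 all vertices in no zone have type 0, and if $w,w'\in V(P_{i+1})$ have nonzero type and all vertices between them on $P_{i+1}$ have type 0, then $wP_{i+1}w'$ has length at least $k-2$, this length being odd if $w,w'$ have a common ancestor and even otherwise. **Uniformity.** A layered wheel (ttf or ehf) is *special* if every bridge has odd length; a bridge then has a middle edge. For $v\in V(P_i)$, $i<l$, let $\mathrm{Dom}(v)$ consist of the vertices of $\mathrm{Box}_v$ outside all bridges, together with the vertices of the bridge on the left of $v$ that lie to the right of its middle edge (including the right end of that edge) and the vertices of the bridge on the right of $v$ that lie to the left of its middle edge (including the left end of that edge); a missing bridge contributes nothing. For an integer $m$, a special layered wheel is *$m$-uniform* if $|\mathrm{Dom}(v)|=m$ for every $v\in V(P_0)\cup\dots\cup V(P_{l-1})$. **Rankwidth.** For $X\subseteq V(G)$, $\mathrm{cutrk}_G(X)$ is the rank over $\mathrm{GF}(2)$ of the submatrix of the adjacency matrix with rows $X$ and columns $V(G)\setminus X$. A rank decomposition of $G$ is a tree $T$ with at least two vertices, all of whose non-leaves have degree 3, with a bijection $\lambda$ from $V(G)$ to the leaves of $T$. Its width is the maximum, over edges $e$ of $T$, of $\mathrm{cutrk}_G(\lambda^{-1}(A_e))$,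 where $A_e$ is the set of leaves of $T$ in one component of $T\setminus e$. The rankwidth $\mathrm{rw}(G)$ is the minimum width of a rank decomposition of $G$ (and $0$ if $|V(G)|\le1$). **Theorem.** For all integers $l\ge 2$ and $k\ge 4$ there is an integer $m$ such that $m$-uniform $(l,k)$-ttf-layered-wheels and $m$-uniform $(l,k)$-ehf-layered-wheels exist, and every $m$-uniform $(l,k)$-layered-wheel $G$ (ttf or ehf) satisfies $\mathrm{rw}(G)\ge l$. -/

import Mathlib

/-! # Rankwidth of finite graphs -/

universe u

namespace Rankwidth

variable {V : Type u}

open Classical in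
/-- The cut-rank of `X`: the rank over the binary field of the submatrix `A_G[X, V \ X]` of the
adjacency matrix of `G`. -/
noncomputable def cutRank [Fintype V] (G : SimpleGraph V) (X : Set V) : ℕ :=
  ((G.adjMatrix (ZMod 2)).submatrix
    (fun x : {x : V // x ∈ X} => x.1) (fun y : {y : V // y ∉ X} => y.1)).rank

/-- A leaf is a vertex incident to exactly one edge. -/
def IsLeaf {W : Type*} (T : SimpleGraph W) (x : W) : Prop :=
  (T.neighborSet x).ncard = 1

/-- A cubic tree: a tree with at least two vertices in which every vertex that is not a leaf has
degree three. -/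
structure IsCubicTree {W : Type*} (T : SimpleGraph W) : Prop where
  isTree : T.IsTree
  nontrivial : Nontrivial W
  cubic : ∀ x, ¬ IsLeaf T x → (T.neighborSet x).ncard = 3

/-- A rank decomposition of a graph with vertex set `V`: a finite cubic tree and a bijection from
`V` to the leaves of that tree. -/
structure RankDecomposition (V : Type u) where
  Node : Type
  [fintypeNode : Fintype Node]
  tree : SimpleGraph Node
  isCubicTree : IsCubicTree tree
  leafEquiv : V ≃ {x : Node // IsLeaf tree x}

attribute [instance] RankDecomposition.fintypeNode

/-- For an edge `ab` of the tree, the set of vertices of the graph whose leaf lies in the component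
of `a` after removing the edge `ab`. -/
def RankDecomposition.side (D : RankDecomposition V) (a b : D.Node) : Set V :=
  {v | (D.tree.deleteEdges {s(a, b)}).Reachable a (D.leafEquiv v).1}

open Classical in
/-- The width of a rank decomposition: the maximum over all edges `ab` of the tree of the cut-rank
of the induced bipartition of the vertex set.  (Each edge is counted in both directions, which is
harmless because the cut-ranks of a set and of its complement agree.) -/
noncomputable def RankDecomposition.width [Fintype V] (D : RankDecomposition V)
    (G : SimpleGraph V) : ℕ :=
  (Finset.univ.filter fun p : D.Node × D.Node => D.tree.Adj p.1 p.2).sup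
    fun p => cutRank G (D.side p.1 p.2)

/-- The rankwidth: the minimum width of a rank decomposition, and `0` if there is at most one
vertex. -/
noncomputable def rankwidth [Fintype V] (G : SimpleGraph V) : ℕ :=
  if Fintype.card V ≤ 1 then 0 else sInf {w | ∃ D : RankDecomposition V, D.width G = w}

end Rankwidth

/-! # Layered wheels

Paths are given by the lists of their vertices, read from left to right, so that a path with vertex
list `L` has length `L.length - 1`, and its subpaths are the infixes of `L`. -/

/-- The data of the construction of a layered wheel.

* `layer i` is the path `P_i`.
* `bridge u v`, for consecutive vertices `u`, `v` (in this order) of a layer `P_i`, is the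
  `uv`-bridge in `P_{i+1}`: in a ttf-layered-wheel the subpath strictly between `Box_u` and `Box_v`;
  in an ehf-layered-wheel the zone `E_{u,v}` shared by `Box_u` and `Box_v`.
* `core u`, for a vertex `u` of `P_i`, is the subpath of `P_{i+1}` strictly between the (at most
  two) bridges of `u`: in a ttf-layered-wheel it is `Box_u`; in an ehf-layered-wheel it is `Box_u`
  without its shared zones `E_{u',u}` and `E_{u,u''}`. -/
structure Layering (V : Type u) where
  layer : ℕ → List V
  core : V → List V
  bridge : V → V → List V

namespace Layering

variable {V : Type u}

/-- For `L = u₀ u₁ … uₙ`, the concatenation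
`core u₀, bridge u₀ u₁, core u₁, bridge u₁ u₂, …, core uₙ`. -/
def weave (S : Layering V) : List V → List V
  | [] => []
  | [x] => S.core x
  | x :: y :: t => S.core x ++ S.bridge x y ++ weave S (y :: t)

/-- The ancestors of `x`: its neighbours in strictly earlier layers.  The type of `x` is the number
of its ancestors. -/
def ancestors (S : Layering V) (G : SimpleGraph V) (x : V) : Set V :=
  {y | G.Adj x y ∧ ∃ i j, j < i ∧ x ∈ S.layer i ∧ y ∈ S.layer j}

open Classical in
/-- The sequence, from left to right, of the ancestor sets of those vertices of the path `L` that
are not of type 0. -/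
noncomputable def marks (S : Layering V) (G : SimpleGraph V) (L : List V) : List (Set V) :=
  (L.filter fun x => S.ancestors G x ≠ ∅).map (S.ancestors G)

/-- Both ends of the path `L` have an ancestor. -/
def EndsMarked (S : Layering V) (G : SimpleGraph V) (L : List V) : Prop :=
  (∀ x ∈ L.head?, S.ancestors G x ≠ ∅) ∧ (∀ x ∈ L.getLast?, S.ancestors G x ≠ ∅)

/-- `w` and `w'` have ancestors, and `w, gap, w'` is a subpath of some layer all of whose internal
vertices are of type 0.  The length of this subpath is `gap.length + 1`. -/
def IsGap (S : Layering V) (G : SimpleGraph V) (w : V) (gap : List V) (w' : V) : Prop :=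
  (∃ i, w :: (gap ++ [w']) <:+: S.layer i) ∧ S.ancestors G w ≠ ∅ ∧ S.ancestors G w' ≠ ∅ ∧
    ∀ x ∈ gap, S.ancestors G x = ∅

/-- The vertex set of `G` is partitioned into paths `P_0, …, P_l`, where `P_0` is a single vertex
and each `P_{i+1}` runs through the cores and bridges in the order of `P_i`; two vertices of the same
layer are adjacent exactly when they are consecutive. -/
structure IsLayered (S : Layering V) (G : SimpleGraph V) (l : ℕ) : Prop where
  layer_zero : ∃ r, S.layer 0 = [r]
  layer_succ : ∀ i < l, S.layer (i + 1) = S.weave (S.layer i)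
  layer_eq_nil : ∀ i, l < i → S.layer i = []
  nodup : ∀ i, (S.layer i).Nodup
  existsUnique_layer : ∀ v, ∃! i, v ∈ S.layer i
  adj_iff : ∀ i, ∀ x ∈ S.layer i, ∀ y ∈ S.layer i,
    (G.Adj x y ↔ [x, y] <:+: S.layer i ∨ [y, x] <:+: S.layer i)

/-- `(l, k)`-ttf-layered-wheels. -/
structure IsTTFLayeredWheel (S : Layering V) (G : SimpleGraph V) (l k : ℕ) : Prop
    extends S.IsLayered G l where
  box_ends : ∀ i < l, ∀ x ∈ S.layer i, S.EndsMarked G (S.core x)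
  box_type_zero : ∀ i < l, ∀ x ∈ S.layer i, S.ancestors G x = ∅ →
    S.marks G (S.core x) = List.replicate 3 {x}
  box_type_one : ∀ i < l, ∀ x ∈ S.layer i, ∀ v, S.ancestors G x = {v} →
    S.marks G (S.core x) = List.replicate 3 {x} ++ List.replicate 3 {v} ++ List.replicate 3 {x}
  bridge_type_zero : ∀ i < l, ∀ x y, [x, y] <:+: S.layer i →
    ∀ z ∈ S.bridge x y, S.ancestors G z = ∅
  gap_length : ∀ w gap w', S.IsGap G w gap w' → k - 2 ≤ gap.length + 1

/-- The order in which the two ancestors of a vertex of type 2 are listed: the one in the later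
layer first, and from left to right if they lie in the same layer. -/
def Precedes (S : Layering V) (v w : V) : Prop :=
  (∃ i j, j < i ∧ v ∈ S.layer i ∧ w ∈ S.layer j) ∨ ∃ i, List.Sublist [v, w] (S.layer i)

/-- `(l, k)`-ehf-layered-wheels.  A zone `E_A` (resp. `O_A`) is a subpath containing four
(resp. three) vertices with ancestor set `A`, two of which are its ends, and whose other vertices
are of type 0. -/
structure IsEHFLayeredWheel (S : Layering V) (G : SimpleGraph V) (l k : ℕ) : Prop
    extends S.IsLayered G l where
  layer_ends : ∀ i < l, S.EndsMarked G (S.layer (i + 1))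
  bridge_ends : ∀ i < l, ∀ x y, [x, y] <:+: S.layer i → S.EndsMarked G (S.bridge x y)
  /-- The shared zone `E_{x,y}`. -/
  bridge_zone : ∀ i < l, ∀ x y, [x, y] <:+: S.layer i →
    S.marks G (S.bridge x y) = List.replicate 4 {x, y}
  /-- The zone `O_x`. -/
  core_type_zero : ∀ i < l, ∀ x ∈ S.layer i, S.ancestors G x = ∅ →
    S.marks G (S.core x) = List.replicate 3 {x}
  /-- The zones `O_x, O_{x,v}, O_x`. -/
  core_type_one : ∀ i < l, ∀ x ∈ S.layer i, ∀ v, S.ancestors G x = {v} →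
    S.marks G (S.core x) =
      List.replicate 3 {x} ++ List.replicate 3 {x, v} ++ List.replicate 3 {x}
  /-- The zones `E_x, E_{v,w}, O_x, O_{x,v}, O_x, O_{x,w}, O_x, E_{v,w}, E_x`. -/
  core_type_two : ∀ i < l, ∀ x ∈ S.layer i, ∀ v w, S.Precedes v w → S.ancestors G x = {v, w} →
    S.marks G (S.core x) =
      List.replicate 4 {x} ++ List.replicate 4 {v, w} ++ List.replicate 3 {x} ++
      List.replicate 3 {x, v} ++ List.replicate 3 {x} ++ List.replicate 3 {x, w} ++
      List.replicate 3 {x} ++ List.replicate 4 {v, w} ++ List.replicate 4 {x}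
  gap_length : ∀ w gap w', S.IsGap G w gap w' → k - 2 ≤ gap.length + 1
  gap_odd : ∀ w gap w', S.IsGap G w gap w' →
    (S.ancestors G w ∩ S.ancestors G w').Nonempty → Odd (gap.length + 1)
  gap_even : ∀ w gap w', S.IsGap G w gap w' →
    ¬ (S.ancestors G w ∩ S.ancestors G w').Nonempty → Even (gap.length + 1)

/-- Every bridge has odd length. -/
def IsSpecial (S : Layering V) (l : ℕ) : Prop :=
  ∀ i < l, ∀ x y, [x, y] <:+: S.layer i → Odd ((S.bridge x y).length - 1)

/-- The domain of a vertex `v` of the layer `P_i`: the core of `v`, the part of the bridge on its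
left after the middle edge, and the part of the bridge on its right before the middle edge (a missing
bridge contributes nothing). -/
def dom (S : Layering V) (i : ℕ) (v : V) : Set V :=
  {z | z ∈ S.core v ∨
    (∃ x, [x, v] <:+: S.layer i ∧ z ∈ (S.bridge x v).drop ((S.bridge x v).length / 2)) ∨
    (∃ y, [v, y] <:+: S.layer i ∧ z ∈ (S.bridge v y).take ((S.bridge v y).length / 2))}

/-- A special layered wheel is `m`-uniform if the domain of every vertex outside the last layer has
exactly `m` vertices. -/
def IsUniform (S : Layering V) (l m : ℕ) : Prop :=
  S.IsSpecial l ∧ ∀ i < l, ∀ v ∈ S.layer i, (S.dom i v).ncard = m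

end Layering

/-! Lower bound. Some edge of any rank decomposition has at least a third of the vertices on each
side (`RankDecomposition.exists_balanced`), so it suffices that every balanced cut `(X, Xᶜ)` has
cut-rank at least `l`. Cut-rank is bounded below by `card_le_cutRank`: crossing edges that can be
ordered so that each has an end not adjacent to the opposite ends of the earlier ones give a
submatrix that is eliminated edge by edge.

By uniformity layer `i` has `m ^ i` vertices, and descent from layer to layer is read off by
division by `m`; `IsWheelModel` keeps only this numbering and the adjacencies that matter. Each
vertex of layer 1 owns a block of `m ^ (l - 1)` vertices of the last layer. Every block that meets
both sides contains a crossing edge, and these edges are independent, so it may be assumed that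
fewer than `l` blocks are mixed. As `m > 3 * (l + 1)` and most vertices are in the last layer, some
block `bX` lies in `X` and some block `bY` in `Xᶜ`.

Now each layer `i` from 1 to `l` yields a crossing edge. Call the layer good if all descendants of
`bX` in it are in `X` and all those of `bY` are in `Xᶜ`. A good layer is a path that crosses the
cut, and one end of the crossing edge has no ancestors because marked vertices are never
consecutive. In a bad layer some descendant `p` of `bX` (or of `bY`) is on the wrong side. It has a
neighbour in the last layer, below it and hence on the right side, whose other ancestors all descend
from `p`: boxes hand ancestors down from layer to layer (`exists_descendant`). Good layers first,
then bad ones, both from the top down, is an elimination order.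

Existence. The vertices are the pairs `(i, q)` with `q < m ^ i`, and the ancestors in the domain of
a vertex are prescribed by a word of length `m` that depends on the vertex and on its own ancestors.
The zones fix the marks of the word; all gaps are short except one, between two marks `[u]` of the
core, which absorbs the missing length. In the ehf case that gap needs the right parity, which an
odd `m` provides. -/

namespace Rankwidth

/-! ### Lower bounds for the cut-rank -/

variable {V : Type u}

/-- Triangular elimination: a system of edges `r i, c i` across the cut, each of which has an end
without neighbours in the opposite ends of the edges of smaller key, is counted by the cut-rank. -/
theorem card_le_cutRank {ι κ : Type*} [LinearOrder κ] [Fintype V] (G : SimpleGraph V) (X : Set V)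
    (s : Finset ι) (key : ι → κ) (r c : ι → V) (hkey : ∀ i ∈ s, ∀ j ∈ s, key i = key j → i = j)
    (hr : ∀ i ∈ s, r i ∈ X) (hc : ∀ i ∈ s, c i ∉ X) (hadj : ∀ i ∈ s, G.Adj (r i) (c i))
    (helim : ∀ i ∈ s, (∀ j ∈ s, key j < key i → ¬ G.Adj (r i) (c j)) ∨
      ∀ j ∈ s, key j < key i → ¬ G.Adj (r j) (c i)) :
    s.card ≤ cutRank G X := by
  classical
  -- The matrix of the `r i` against the `c j` is injective, by induction on the largest key `a`.
  -- Off the diagonal, row `a` or column `a` vanishes. In the first case row `a` gives `x a = 0` and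
  -- `a` can be dropped; in the second the other rows do not involve `x a`, so the other unknowns
  -- vanish first and row `a` then gives `x a = 0`.
  have key_lemma : ∀ x : ι → ZMod 2,
      (∀ i ∈ s, ∑ j ∈ s, G.adjMatrix (ZMod 2) (r i) (c j) * x j = 0) → ∀ j ∈ s, x j = 0 := by
    intro x
    revert hkey hr hc hadj helim
    induction s using Finset.induction_on_max_value key with
    | empty => simp
    | insert a s has hmax ih =>
      intro hkey hr hc hadj helim hx
      have hlt : ∀ j ∈ s, key j < key a := fun j hj =>
        lt_of_le_of_ne (hmax j hj) fun h => has
          (hkey j (Finset.mem_insert_of_mem hj) a (Finset.mem_insert_self _ _) h ▸ hj)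
      have haa : G.adjMatrix (ZMod 2) (r a) (c a) = 1 := by
        simp [hadj a (Finset.mem_insert_self _ _)]
      have ih' := ih (fun i hi j hj => hkey i (Finset.mem_insert_of_mem hi) j
          (Finset.mem_insert_of_mem hj))
        (fun i hi => hr i (Finset.mem_insert_of_mem hi))
        (fun i hi => hc i (Finset.mem_insert_of_mem hi))
        (fun i hi => hadj i (Finset.mem_insert_of_mem hi))
        (fun i hi => (helim i (Finset.mem_insert_of_mem hi)).imp
          (fun h j hj => h j (Finset.mem_insert_of_mem hj))
          (fun h j hj => h j (Finset.mem_insert_of_mem hj)))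
      have hxa := hx a (Finset.mem_insert_self _ _)
      rw [Finset.sum_insert has, haa, one_mul] at hxa
      have hxs : ∀ i ∈ s, G.adjMatrix (ZMod 2) (r i) (c a) * x a +
          ∑ j ∈ s, G.adjMatrix (ZMod 2) (r i) (c j) * x j = 0 := fun i hi => by
        have := hx i (Finset.mem_insert_of_mem hi)
        rwa [Finset.sum_insert has] at this
      rcases helim a (Finset.mem_insert_self _ _) with h | h
      · have h0 : x a = 0 := by
          rw [Finset.sum_eq_zero, add_zero] at hxa
          · exact hxa
          · intro j hj
            simp [h j (Finset.mem_insert_of_mem hj) (hlt j hj)]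
        have := ih' (fun i hi => by simpa [h0] using hxs i hi)
        intro j hj
        rcases Finset.mem_insert.1 hj with rfl | hj
        · exact h0
        · exact this j hj
      · have := ih' (fun i hi => by
          simpa [h i (Finset.mem_insert_of_mem hi) (hlt i hi)] using hxs i hi)
        intro j hj
        rcases Finset.mem_insert.1 hj with rfl | hj
        · rw [Finset.sum_eq_zero, add_zero] at hxa
          · exact hxa
          · intro i hi
            simp [this i hi]
        · exact this j hj
  set M : Matrix {x : V // x ∈ X} {y : V // y ∉ X} (ZMod 2) :=
    (G.adjMatrix (ZMod 2)).submatrix (fun x => x.1) (fun y => y.1) with hM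
  have hli : LinearIndependent (ZMod 2) (fun j : s => M.col ⟨c j, hc j j.2⟩) := by
    rw [Fintype.linearIndependent_iff]
    intro g hg
    have := key_lemma (fun i => if h : i ∈ s then g ⟨i, h⟩ else 0) (by
      intro i hi
      have := congrFun hg ⟨r i, hr i hi⟩
      simp only [Finset.sum_apply, Pi.smul_apply, smul_eq_mul, Pi.zero_apply] at this
      rw [← this, ← Finset.sum_coe_sort s]
      refine Finset.sum_congr rfl fun j _ => ?_
      simp [hM, Matrix.col, mul_comm])
    intro i
    simpa using this i i.2
  have h1 := finrank_span_eq_card hli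
  have h2 : cutRank G X = M.rank := by
    unfold cutRank; rw [hM]
  rw [h2, Matrix.rank_eq_finrank_span_cols]
  rw [Fintype.card_coe] at h1
  rw [← h1]
  exact Submodule.finrank_mono (Submodule.span_mono (by
    rintro _ ⟨j, rfl⟩
    exact ⟨_, rfl⟩))

end Rankwidth

/-! ### Balanced edges of rank decompositions -/

namespace Rankwidth

variable {V : Type u}

section Tree

variable {W : Type*} {T : SimpleGraph W}

/-- The nodes on the side of `b` of the edge `ba`. -/
def nodeSide (T : SimpleGraph W) (b a : W) : Set W :=
  {x | (T.deleteEdges {s(b, a)}).Reachable b x}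

theorem mem_nodeSide_iff {a b x : W} :
    x ∈ nodeSide T b a ↔ ∃ p : T.Walk b x, s(b, a) ∉ p.edges :=
  SimpleGraph.reachable_deleteEdges_iff_exists_walk

/-- A path does not return to its first node `b`, so after its first edge `bc` it never uses that
edge again. -/
theorem eq_or_mem_nodeSide_of_isPath {b x : W} (p : T.Walk b x) (hp : p.IsPath) :
    x = b ∨ ∃ c, T.Adj b c ∧ s(b, c) ∈ p.edges ∧ x ∈ nodeSide T c b := by
  cases p with
  | nil => exact Or.inl rfl
  | @cons _ c _ h q =>
    rw [SimpleGraph.Walk.cons_isPath_iff] at hp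
    refine Or.inr ⟨c, h, by simp, mem_nodeSide_iff.2 ⟨q, fun hq => hp.2 ?_⟩⟩
    exact SimpleGraph.Walk.snd_mem_support_of_mem_edges q hq

theorem eq_or_mem_nodeSide {a b x : W} (hx : x ∈ nodeSide T b a) :
    x = b ∨ ∃ c, T.Adj b c ∧ c ≠ a ∧ x ∈ nodeSide T c b := by
  classical
  obtain ⟨p, hp⟩ := mem_nodeSide_iff.1 hx
  refine (eq_or_mem_nodeSide_of_isPath p.bypass p.bypass_isPath).imp id ?_
  rintro ⟨c, hc, hcp, hxc⟩
  refine ⟨c, hc, ?_, hxc⟩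
  rintro rfl
  exact hp (p.edges_bypass_subset_edges hcp)

theorem mem_nodeSide_or (hT : T.Connected) {a b : W} (x : W) :
    x ∈ nodeSide T b a ∨ x ∈ nodeSide T a b := by
  classical
  obtain ⟨p⟩ := hT.preconnected b x
  by_cases h : s(b, a) ∈ p.bypass.edges
  · right
    have hp := p.bypass_isPath
    revert h hp
    generalize p.bypass = q
    intro h hq
    cases q with
    | nil => simp at h
    | @cons _ c _ h' q =>
      rw [SimpleGraph.Walk.cons_isPath_iff] at hq
      have hbq : ∀ y, s(b, y) ∉ q.edges := fun y hy =>
        hq.2 (SimpleGraph.Walk.fst_mem_support_of_mem_edges q hy)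
      simp only [SimpleGraph.Walk.edges_cons, List.mem_cons, hbq, or_false] at h
      have : a = c := by
        rcases Sym2.eq_iff.1 h with ⟨-, h⟩ | ⟨h, h2⟩
        · exact h
        · exact absurd h h'.ne
      subst this
      exact mem_nodeSide_iff.2 ⟨q, by rw [Sym2.eq_swap]; exact hbq a⟩
  · exact Or.inl (mem_nodeSide_iff.2 ⟨_, h⟩)

theorem notMem_nodeSide (hT : T.IsAcyclic) {b c : W} (h : T.Adj b c) : b ∉ nodeSide T c b := by
  have := SimpleGraph.isBridge_iff.1 (SimpleGraph.isAcyclic_iff_forall_adj_isBridge.1 hT h.symm)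
  exact this

/-- As `bc` is a bridge, a walk from `c` that avoids this edge never meets `b`, so preceded by `bc`
it still avoids `ba`. The inclusion is strict because of `b`; it drives the minimality argument in
`RankDecomposition.exists_balanced`. -/
theorem nodeSide_ssubset (hT : T.IsAcyclic) {a b c : W} (h : T.Adj b c) (hca : c ≠ a) :
    nodeSide T c b ⊂ nodeSide T b a := by
  classical
  have hb := notMem_nodeSide hT h
  refine ⟨fun x hx => ?_, fun hs => hb (hs ?_)⟩
  · obtain ⟨p, hp⟩ := mem_nodeSide_iff.1 hx
    have hbp : b ∉ p.support := fun hbp => hb (mem_nodeSide_iff.2 ⟨p.takeUntil b hbp, fun h' =>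
      hp (p.edges_takeUntil_subset_edges hbp h')⟩)
    refine mem_nodeSide_iff.2 ⟨SimpleGraph.Walk.cons h p, ?_⟩
    simp only [SimpleGraph.Walk.edges_cons, List.mem_cons, not_or]
    refine ⟨fun he => ?_, fun he => hbp (SimpleGraph.Walk.fst_mem_support_of_mem_edges p he)⟩
    rcases Sym2.eq_iff.1 he with ⟨-, h'⟩ | ⟨h', -⟩
    · exact hca h'.symm
    · exact h.ne h'
  · exact mem_nodeSide_iff.2 ⟨SimpleGraph.Walk.nil, by simp⟩

end Tree

/-- Some edge of a rank decomposition has at least a third of the vertices on either side. -/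
theorem RankDecomposition.exists_balanced [Fintype V] (D : RankDecomposition V)
    (hV : 4 ≤ Fintype.card V) :
    ∃ a b, D.tree.Adj a b ∧ Fintype.card V ≤ 3 * (D.side a b).ncard ∧
      Fintype.card V ≤ 3 * (D.side a b)ᶜ.ncard := by
  classical
  have hT := D.isCubicTree.isTree
  set S : Finset (D.Node × D.Node) := Finset.univ.filter fun p =>
    D.tree.Adj p.1 p.2 ∧ Fintype.card V ≤ 3 * (D.side p.1 p.2).ncard with hS
  have hSne : S.Nonempty := by
    have := D.isCubicTree.nontrivial
    obtain ⟨x⟩ := hT.1.nonempty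
    obtain ⟨y, hxy⟩ := hT.1.preconnected.exists_adj_of_nontrivial x
    have hcov : (Set.univ : Set V) ⊆ D.side x y ∪ D.side y x := fun v _ =>
      mem_nodeSide_or hT.1 _
    have h1 := (Set.ncard_le_ncard hcov (Set.toFinite _)).trans (Set.ncard_union_le _ _)
    rw [Set.ncard_univ, Nat.card_eq_fintype_card] at h1
    by_cases h : Fintype.card V ≤ 3 * (D.side x y).ncard
    · exact ⟨(x, y), by simp [hS, hxy, h]⟩
    · refine ⟨(y, x), ?_⟩
      simp only [hS, Finset.mem_filter, Finset.mem_univ, true_and]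
      exact ⟨hxy.symm, by omega⟩
  -- Among the directed edges whose side holds at least a third of the vertices, one with the fewest
  -- nodes on that side. Beyond `b` each further side is then below a third, so the side of `b` is
  -- below two thirds.
  obtain ⟨⟨b, a⟩, hba, hmin⟩ := S.exists_min_image (fun p => (nodeSide D.tree p.1 p.2).ncard) hSne
  simp only [hS, Finset.mem_filter, Finset.mem_univ, true_and, Prod.forall] at hba hmin
  refine ⟨b, a, hba.1, hba.2, ?_⟩
  have hsmall : ∀ c, D.tree.Adj b c → c ≠ a → 3 * (D.side c b).ncard < Fintype.card V := by
    intro c hc hca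
    by_contra hcon
    have h1 := hmin c b ⟨hc.symm, not_lt.1 hcon⟩
    have h2 := Set.ncard_lt_ncard (nodeSide_ssubset hT.2 hc hca) (Set.toFinite _)
    omega
  have hcompl := Set.ncard_add_ncard_compl (D.side b a)
  rw [Nat.card_eq_fintype_card] at hcompl
  by_cases hleaf : IsLeaf D.tree b
  -- At a leaf the side has at most one vertex, less than a third of four or more.
  · exfalso
    obtain ⟨a', ha'⟩ := Set.ncard_eq_one.1 hleaf
    have hsub : D.side b a ⊆ {D.leafEquiv.symm ⟨b, hleaf⟩} := by
      intro v hv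
      rcases eq_or_mem_nodeSide hv with h | ⟨c, hc, hca, -⟩
      · simp only [Set.mem_singleton_iff, Equiv.eq_symm_apply]
        exact Subtype.ext h
      · have h1 : c ∈ D.tree.neighborSet b := hc
        have h2 : a ∈ D.tree.neighborSet b := hba.1
        rw [ha', Set.mem_singleton_iff] at h1 h2
        exact absurd (h1.trans h2.symm) hca
    have := Set.ncard_le_ncard hsub (Set.toFinite _)
    rw [Set.ncard_singleton] at this
    omega
  · have h3 := D.isCubicTree.cubic b hleaf
    have h2 : (D.tree.neighborSet b \ {a}).ncard = 2 := by
      rw [Set.ncard_sdiff_singleton_of_mem (show a ∈ D.tree.neighborSet b from hba.1), h3]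
    obtain ⟨c, d, hcd, hcd'⟩ := Set.ncard_eq_two.1 h2
    have hc : c ∈ D.tree.neighborSet b \ {a} := by simp [hcd']
    have hd : d ∈ D.tree.neighborSet b \ {a} := by simp [hcd']
    have hsub : D.side b a ⊆ D.side c b ∪ D.side d b := by
      intro v hv
      rcases eq_or_mem_nodeSide hv with h | ⟨e, he, hea, hve⟩
      · exact absurd (h ▸ (D.leafEquiv v).2) hleaf
      · have : e ∈ D.tree.neighborSet b \ {a} := ⟨he, hea⟩
        rw [hcd'] at this
        rcases this with rfl | rfl
        · exact Or.inl hve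
        · exact Or.inr hve
    have h4 := (Set.ncard_le_ncard hsub (Set.toFinite _)).trans (Set.ncard_union_le _ _)
    have h5 := hsmall c hc.1 hc.2
    have h6 := hsmall d hd.1 hd.2
    omega

/-! ### Existence of rank decompositions -/

section Existence

/-- The parent in the binary heap numbered from `2`, whose two roots `2` and `3` are adjacent. -/
def heapParent (k : ℕ) : ℕ := if k = 2 then 3 else if k = 3 then 2 else k / 2

/-- The binary heap with leaves `n, …, 2n - 1`. -/
def heapTree (n : ℕ) : SimpleGraph (Set.Ico 2 (2 * n)) where
  Adj a b := heapParent a = b ∨ heapParent b = a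
  symm := ⟨fun _ _ h => h.symm⟩
  loopless := ⟨fun a h => by
    have h2 := a.2.1
    have : heapParent a.1 = a.1 := h.elim id id
    unfold heapParent at this
    split_ifs at this <;> omega⟩

theorem heapTree_connected {n : ℕ} (hn : 2 ≤ n) : (heapTree n).Connected := by
  have h2 : 2 ∈ Set.Ico 2 (2 * n) := ⟨le_rfl, by omega⟩
  have key : ∀ k (hk : k ∈ Set.Ico 2 (2 * n)), (heapTree n).Reachable ⟨k, hk⟩ ⟨2, h2⟩ := by
    intro k
    induction k using Nat.strong_induction_on with
    | _ k ih =>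
      intro hk
      by_cases hk2 : k = 2
      · subst hk2; exact SimpleGraph.Reachable.refl _
      · have h1 : 2 ≤ heapParent k ∧ heapParent k < k := by
          have := hk.1
          unfold heapParent
          split_ifs <;> omega
        have h3 : heapParent k ∈ Set.Ico 2 (2 * n) := ⟨h1.1, h1.2.trans hk.2⟩
        have h4 : (heapTree n).Adj ⟨k, hk⟩ ⟨heapParent k, h3⟩ := Or.inl rfl
        exact h4.reachable.trans (ih _ h1.2 h3)
  have : Nonempty (Set.Ico 2 (2 * n)) := ⟨⟨2, h2⟩⟩
  exact ⟨fun a b => (key a a.2).trans (key b b.2).symm⟩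

theorem heapTree_isTree {n : ℕ} (hn : 2 ≤ n) : (heapTree n).IsTree := by
  classical
  have hc := heapTree_connected hn
  refine SimpleGraph.isTree_iff_connected_and_card.2 ⟨hc, le_antisymm ?_ ?_⟩
  · have h2 : 2 ∈ Set.Ico 2 (2 * n) := ⟨le_rfl, by omega⟩
    have hpar : ∀ k : Set.Ico 2 (2 * n), heapParent k.1 ∈ Set.Ico 2 (2 * n) := fun k => by
      have := k.2.1
      have := k.2.2
      unfold heapParent
      split_ifs <;> constructor <;> omega
    -- Every edge joins a node other than 2 to its parent, the edge between 2 and 3 being charged to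
    -- 3. Hence there are fewer edges than nodes.
    have hsub : (heapTree n).edgeSet ⊆ (fun k : Set.Ico 2 (2 * n) =>
        s(k, (⟨heapParent k, hpar k⟩ : Set.Ico 2 (2 * n)))) '' {⟨2, h2⟩}ᶜ := by
      intro e
      induction e using Sym2.ind with
      | _ a b =>
        have key : ∀ a b : Set.Ico 2 (2 * n), heapParent a.1 = b.1 →
            s(a, b) ∈ (fun k : Set.Ico 2 (2 * n) =>
              s(k, (⟨heapParent k, hpar k⟩ : Set.Ico 2 (2 * n)))) '' {⟨2, h2⟩}ᶜ := by
          intro a b h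
          by_cases ha : a.1 = 2
          · have hb : b.1 = 3 := by rw [← h, ha]; rfl
            refine ⟨b, fun hb' => ?_, ?_⟩
            · rw [Set.mem_singleton_iff.1 hb'] at hb
              exact absurd hb (by simp)
            · have : (⟨heapParent b, hpar b⟩ : Set.Ico 2 (2 * n)) = a :=
                Subtype.ext (by simp [hb, ha, heapParent])
              simp only [this]
              exact Sym2.eq_swap
          · refine ⟨a, fun ha' => ha (by rw [Set.mem_singleton_iff.1 ha']), ?_⟩
            have : (⟨heapParent a, hpar a⟩ : Set.Ico 2 (2 * n)) = b := Subtype.ext h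
            simp only [this]
        rintro (h | h)
        · exact key a b h
        · rw [Sym2.eq_swap]; exact key b a h
    have h1 := (Set.ncard_le_ncard hsub (Set.toFinite _)).trans
      (Set.ncard_image_le (Set.toFinite _))
    have h3 := Set.ncard_add_ncard_compl ({⟨2, h2⟩} : Set (Set.Ico 2 (2 * n)))
    rw [Set.ncard_singleton] at h3
    rw [Nat.card_coe_set_eq]
    omega
  · exact hc.card_vert_le_card_edgeSet_add_one

theorem heapTree_neighborSet {n : ℕ} (x : Set.Ico 2 (2 * n)) :
    (heapTree n).neighborSet x = 
      {y : Set.Ico 2 (2 * n) | y.1 = heapParent x.1 ∨ y.1 = 2 * x.1 ∨ y.1 = 2 * x.1 + 1} := by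
  ext y
  have hx := x.2.1
  have hy := y.2.1
  simp only [SimpleGraph.mem_neighborSet, heapTree, heapParent, Set.mem_ofPred_eq]
  split_ifs <;> omega

theorem heapTree_ncard_of_le {n : ℕ} (x : Set.Ico 2 (2 * n)) (hx : n ≤ x.1) :
    ((heapTree n).neighborSet x).ncard = 1 := by
  have h2 := x.2.1
  have h3 := x.2.2
  have hp : heapParent x ∈ Set.Ico 2 (2 * n) := by
    unfold heapParent
    split_ifs <;> constructor <;> omega
  rw [Set.ncard_eq_one]
  refine ⟨⟨heapParent x, hp⟩, ?_⟩
  rw [heapTree_neighborSet]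
  ext y
  have hy := y.2.2
  simp only [Set.mem_ofPred_eq, Set.mem_singleton_iff, Subtype.ext_iff]
  omega

/-- The root 1 of the usual heap would have degree two. With it suppressed and 2 joined to 3, each
internal node has its parent and two children, all distinct. -/
theorem heapTree_ncard_of_lt {n : ℕ} (x : Set.Ico 2 (2 * n)) (hx : x.1 < n) :
    ((heapTree n).neighborSet x).ncard = 3 := by
  have h2 := x.2.1
  have h3 := x.2.2
  have hp : heapParent x ∈ Set.Ico 2 (2 * n) := by
    unfold heapParent
    split_ifs <;> constructor <;> omega
  have hp' : heapParent x ≠ 2 * x ∧ heapParent x ≠ 2 * x + 1 := by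
    unfold heapParent
    split_ifs <;> constructor <;> omega
  rw [Set.ncard_eq_three]
  refine ⟨⟨heapParent x, hp⟩, ⟨2 * x, by constructor <;> omega⟩,
    ⟨2 * x + 1, by constructor <;> omega⟩, ?_, ?_, ?_, ?_⟩
  · exact fun h => hp'.1 (congrArg Subtype.val h)
  · exact fun h => hp'.2 (congrArg Subtype.val h)
  · intro h
    have := congrArg Subtype.val h
    simp only at this
    omega
  · rw [heapTree_neighborSet]
    ext y
    simp [Subtype.ext_iff]

theorem heapTree_isLeaf_iff {n : ℕ} (x : Set.Ico 2 (2 * n)) :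
    IsLeaf (heapTree n) x ↔ n ≤ x.1 := by
  refine ⟨fun h => ?_, heapTree_ncard_of_le x⟩
  by_contra hlt
  have := heapTree_ncard_of_lt x (not_le.1 hlt)
  unfold IsLeaf at h
  omega

/-- Every graph with at least two vertices has a rank decomposition. -/
theorem nonempty_rankDecomposition [Fintype V] (hV : 2 ≤ Fintype.card V) :
    Nonempty (RankDecomposition V) := by
  classical
  set n := Fintype.card V
  refine ⟨⟨Set.Ico 2 (2 * n), heapTree n, ⟨heapTree_isTree hV, ?_, ?_⟩, ?_⟩⟩
  · exact ⟨⟨2, by constructor <;> omega⟩, ⟨3, by constructor <;> omega⟩,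
      fun h => by
        have := congrArg Subtype.val h
        simp only at this
        omega⟩
  · intro x hx
    rw [heapTree_isLeaf_iff, not_le] at hx
    exact heapTree_ncard_of_lt x hx
  · refine (Fintype.equivFin V).trans
      { toFun := fun i => ⟨⟨n + i, by constructor <;> omega⟩, (heapTree_isLeaf_iff _).2 (by simp)⟩
        invFun := fun x => ⟨x.1.1 - n, ?_⟩
        left_inv := fun i => by simp
        right_inv := fun x => ?_ }
    · have := x.1.2.2
      omega
    · have := (heapTree_isLeaf_iff _).1 x.2
      ext
      simp only
      omega

end Existence

/-- A graph has rankwidth at least `l` if all its balanced cuts have cut-rank at least `l`. -/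
theorem le_rankwidth [Fintype V] (G : SimpleGraph V) (l : ℕ) (hV : 4 ≤ Fintype.card V)
    (h : ∀ X : Set V, Fintype.card V ≤ 3 * X.ncard → Fintype.card V ≤ 3 * Xᶜ.ncard →
      l ≤ cutRank G X) : l ≤ rankwidth G := by
  classical
  unfold rankwidth
  rw [if_neg (by omega)]
  -- Needed because the infimum of the empty set of naturals is 0.
  obtain ⟨D⟩ := nonempty_rankDecomposition (V := V) (by omega)
  refine le_csInf ⟨_, D, rfl⟩ ?_
  rintro w ⟨D, rfl⟩
  obtain ⟨a, b, hab, h1, h2⟩ := D.exists_balanced hV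
  refine (h _ h1 h2).trans ?_
  unfold RankDecomposition.width
  exact Finset.le_sup (f := fun p : D.Node × D.Node => cutRank G (D.side p.1 p.2))
    (b := (a, b)) (by simpa using hab)

end Rankwidth

/-! ### Balanced cuts of wheel models -/

namespace Rankwidth

variable {V : Type u}

theorem exists_crossing (P : ℕ → Prop) (n a : ℕ) (h : P a ↔ ¬ P (a + n)) :
    ∃ q, a ≤ q ∧ q < a + n ∧ (P q ↔ ¬ P (q + 1)) := by
  induction n with
  | zero => exact absurd h (by simp)
  | succ n ih =>
    by_cases h' : P (a + n) ↔ ¬ P (a + n + 1)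
    · exact ⟨a + n, by omega, by omega, h'⟩
    · obtain ⟨q, h1, h2, h3⟩ := ih (by rw [← add_assoc] at h; tauto)
      exact ⟨q, h1, by omega, h3⟩

theorem exists_crossing_of_ne (P : ℕ → Prop) {s t a b : ℕ} (ha : s ≤ a ∧ a < t)
    (hb : s ≤ b ∧ b < t) (hPa : P a) (hPb : ¬ P b) :
    ∃ q, s ≤ q ∧ q + 1 < t ∧ (P q ↔ ¬ P (q + 1)) := by
  rcases le_total a b with hab | hab
  · obtain ⟨q, h1, h2, h3⟩ := exists_crossing P (b - a) a (by
      rw [Nat.add_sub_cancel' hab]; tauto)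
    exact ⟨q, by omega, by omega, h3⟩
  · obtain ⟨q, h1, h2, h3⟩ := exists_crossing P (a - b) b (by
      rw [Nat.add_sub_cancel' hab]; tauto)
    exact ⟨q, by omega, by omega, h3⟩

/-- The structure of uniform layered wheels that forces large rankwidth: the vertex `f i q` is the
vertex number `q` of the layer `i`, which has `m ^ i` vertices, and its domain in the next layer
consists of the vertices with numbers `s` such that `s / m = q`. -/
structure IsWheelModel (G : SimpleGraph V) (f : ℕ → ℕ → V) (l m : ℕ) : Prop where
  exists_eq : ∀ v, ∃ i ≤ l, ∃ q < m ^ i, f i q = v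
  injOn : Set.InjOn (f l) (Set.Iio (m ^ l))
  adj_iff : ∀ i ≤ l, ∀ q < m ^ i, ∀ q' < m ^ i,
    (G.Adj (f i q) (f i q') ↔ q + 1 = q' ∨ q' + 1 = q)
  sparse : ∀ i ≤ l, ∀ q, q + 1 < m ^ i →
    (∀ j < i, ∀ q' < m ^ j, ¬ G.Adj (f i q) (f j q')) ∨
      ∀ j < i, ∀ q' < m ^ j, ¬ G.Adj (f i (q + 1)) (f j q')
  deep : ∀ i < l, ∀ p < m ^ i, ∃ q < m ^ l, q / m ^ (l - i) = p ∧ 0 < q % m ∧ q % m + 1 < m ∧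
    G.Adj (f l q) (f i p) ∧ ∀ j < l, ∀ q' < m ^ j, G.Adj (f l q) (f j q') →
      (j = i ∧ q' = p) ∨ (i < j ∧ q' / m ^ (j - i) = p)

namespace IsWheelModel

variable {G : SimpleGraph V} {f : ℕ → ℕ → V} {l m : ℕ}

/-- The descendants in layer `j` of the vertex number `b` of layer `1` belong to `X`. -/
def Pure (f : ℕ → ℕ → V) (m : ℕ) (X : Set V) (b j : ℕ) : Prop :=
  ∀ q < m ^ j, q / m ^ (j - 1) = b → f j q ∈ X

/-- The domain number `b` in layer `l` meets both `X` and its complement. -/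
def Mixed (f : ℕ → ℕ → V) (l m : ℕ) (X : Set V) (b : ℕ) : Prop :=
  ∃ q < m ^ l, ∃ q' < m ^ l, q / m ^ (l - 1) = b ∧ q' / m ^ (l - 1) = b ∧ f l q ∈ X ∧ f l q' ∉ X

theorem mixed_compl {X : Set V} {b : ℕ} (h : Mixed f l m Xᶜ b) : Mixed f l m X b := by
  obtain ⟨q, hq, q', hq', h1, h2, h3, h4⟩ := h
  exact ⟨q', hq', q, hq, h2, h1, not_not.1 h4, h3⟩

theorem adj_succ (h : IsWheelModel G f l m) {i q : ℕ} (hi : i ≤ l) (hq : q + 1 < m ^ i) :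
    G.Adj (f i q) (f i (q + 1)) :=
  (h.adj_iff i hi q (by omega) _ hq).2 (Or.inl rfl)

theorem exists_oriented (h : IsWheelModel G f l m) (X : Set V) {i q : ℕ} (hi : i ≤ l)
    (hq : q + 1 < m ^ i) (hX : f i q ∈ X ↔ ¬ f i (q + 1) ∈ X) :
    ∃ r c, r ∈ X ∧ c ∉ X ∧ G.Adj r c ∧
      ((r = f i q ∧ c = f i (q + 1)) ∨ (r = f i (q + 1) ∧ c = f i q)) := by
  by_cases h' : f i q ∈ X
  · exact ⟨_, _, h', hX.1 h', h.adj_succ hi hq, Or.inl ⟨rfl, rfl⟩⟩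
  · exact ⟨_, _, not_not.1 (mt hX.2 h'), h', (h.adj_succ hi hq).symm, Or.inr ⟨rfl, rfl⟩⟩

-- Each mixed block contains a crossing edge between consecutive vertices of the last layer. Its
-- right end is at distance at least two from every earlier block, hence not adjacent to the edges
-- chosen there; this is the elimination order by blocks.
open Classical in
theorem card_mixed_le [Fintype V] (h : IsWheelModel G f l m) (hl : 1 ≤ l) (hm : 0 < m)
    (X : Set V) : ((Finset.range m).filter (Mixed f l m X)).card ≤ cutRank G X := by
  classical
  have hN : 0 < m ^ (l - 1) := pow_pos hm _
  have hml : m ^ l = m * m ^ (l - 1) := by rw [← pow_succ', Nat.sub_add_cancel hl]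
  have key : ∀ b, ∃ q r c, b ∈ (Finset.range m).filter (Mixed f l m X) →
      b * m ^ (l - 1) ≤ q ∧ q + 1 < (b + 1) * m ^ (l - 1) ∧ q + 1 < m ^ l ∧ r ∈ X ∧ c ∉ X ∧
      G.Adj r c ∧ ((r = f l q ∧ c = f l (q + 1)) ∨ (r = f l (q + 1) ∧ c = f l q)) := by
    intro b
    by_cases hb : b ∈ (Finset.range m).filter (Mixed f l m X)
    · obtain ⟨hbm, q, hq, q', hq', h1, h2, h3, h4⟩ := Finset.mem_filter.1 hb
      rw [Finset.mem_range] at hbm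
      rw [Nat.div_eq_iff hN] at h1 h2
      have hs : (b + 1) * m ^ (l - 1) = b * m ^ (l - 1) + m ^ (l - 1) := by ring
      obtain ⟨x, hx1, hx2, hx3⟩ := exists_crossing_of_ne (fun q => f l q ∈ X)
        (s := b * m ^ (l - 1)) (t := (b + 1) * m ^ (l - 1)) (a := q) (b := q')
        (by omega) (by omega) h3 h4
      have hle : (b + 1) * m ^ (l - 1) ≤ m ^ l := by
        rw [hml]; exact Nat.mul_le_mul_right _ hbm
      obtain ⟨r, c, hrc⟩ := h.exists_oriented X le_rfl (hx2.trans_le hle) hx3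
      exact ⟨x, r, c, fun _ => ⟨hx1, hx2, hx2.trans_le hle, hrc⟩⟩
    · have v := f 0 0
      exact ⟨0, v, v, fun hb' => absurd hb' hb⟩
  choose q r c hqrc using key
  refine card_le_cutRank G X _ (id : ℕ → ℕ) r c (fun i _ j _ h => h)
    (fun i hi => (hqrc i hi).2.2.2.1) (fun i hi => (hqrc i hi).2.2.2.2.1)
    (fun i hi => (hqrc i hi).2.2.2.2.2.1) fun i hi => ?_
  have hfar : ∀ j ∈ (Finset.range m).filter (Mixed f l m X), j < i →
      ¬ G.Adj (f l (q i + 1)) (r j) ∧ ¬ G.Adj (f l (q i + 1)) (c j) := by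
    intro j hj hji
    obtain ⟨h1, -, h1', -⟩ := hqrc i hi
    obtain ⟨-, h2, h2', -, -, -, hj⟩ := hqrc j hj
    have h3 : (j + 1) * m ^ (l - 1) ≤ i * m ^ (l - 1) := Nat.mul_le_mul_right _ hji
    have e1 := h.adj_iff l le_rfl (q i + 1) h1' (q j) (by omega)
    have e2 := h.adj_iff l le_rfl (q i + 1) h1' (q j + 1) (by omega)
    rcases hj with ⟨hr, hc⟩ | ⟨hr, hc⟩ <;> rw [hr, hc, e1, e2] <;> omega
  rcases (hqrc i hi).2.2.2.2.2.2 with ⟨-, hc⟩ | ⟨hr, -⟩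
  · refine Or.inr fun j hj hji hadj => (hfar j hj hji).1 ?_
    rw [← hc]; exact hadj.symm
  · refine Or.inl fun j hj hji hadj => (hfar j hj hji).2 ?_
    rw [← hr]; exact hadj

-- Otherwise every vertex of `X` in the last layer lies in a mixed block. With `N = m ^ (l - 1)`,
-- these blocks hold at most `(l - 1) * N` vertices and all earlier layers fewer than `2 * N`, so
-- `X` has at most `(l + 1) * N` vertices, less than a third of the `m * N` in the last layer.
open Classical in
theorem exists_pure [Fintype V] (h : IsWheelModel G f l m) (hl : 1 ≤ l) (hm : 3 * (l + 1) < m)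
    (X : Set V) (hX : Fintype.card V ≤ 3 * X.ncard)
    (hmix : ((Finset.range m).filter (Mixed f l m X)).card < l) :
    ∃ b < m, Pure f m X b l := by
  classical
  by_contra! hcon
  set N := m ^ (l - 1) with hNdef
  have hN : 0 < N := pow_pos (by omega) _
  have hml : m ^ l = m * N := by rw [hNdef, ← pow_succ', Nat.sub_add_cancel hl]
  have hcard : m ^ l ≤ Fintype.card V := by
    have := Finset.card_le_univ ((Finset.range (m ^ l)).image (f l))
    rwa [Finset.card_image_of_injOn (by simpa [Set.Iio] using h.injOn), Finset.card_range] at this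
  have hsub : X.toFinset ⊆ ((Finset.range l).biUnion fun i => (Finset.range (m ^ i)).image (f i)) ∪
      ((Finset.range m).filter (Mixed f l m X)).biUnion
        fun b => (Finset.Ico (b * N) (b * N + N)).image (f l) := by
    intro v hv
    rw [Set.mem_toFinset] at hv
    obtain ⟨i, hi, q, hq, rfl⟩ := h.exists_eq v
    rcases hi.lt_or_eq with hi | rfl
    · exact Finset.mem_union_left _ (Finset.mem_biUnion.2 ⟨i, by simpa using hi,
        Finset.mem_image_of_mem _ (by simpa using hq)⟩)
    · refine Finset.mem_union_right _ (Finset.mem_biUnion.2 ⟨q / N, ?_,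
        Finset.mem_image_of_mem _ ?_⟩)
      · have hqm : q / N < m := by
          rw [Nat.div_lt_iff_lt_mul hN, ← hml]; exact hq
        refine Finset.mem_filter.2 ⟨by simpa using hqm, ?_⟩
        have := hcon _ hqm
        unfold Pure at this
        push Not at this
        obtain ⟨q', hq', h1, h2⟩ := this
        exact ⟨q, hq, q', hq', rfl, h1, hv, h2⟩
      · have h1 := Nat.div_add_mod q N
        have h2 := Nat.mod_lt q hN
        rw [mul_comm] at h1
        rw [Finset.mem_Ico]
        omega
  have h1 := (Finset.card_le_card hsub).trans (Finset.card_union_le _ _)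
  have h2 : ((Finset.range l).biUnion fun i => (Finset.range (m ^ i)).image (f i)).card ≤ 2 * N := by
    refine Finset.card_biUnion_le.trans ?_
    refine (Finset.sum_le_sum (g := fun i => m ^ i) fun i _ =>
      Finset.card_image_le.trans (by simp)).trans ?_
    obtain ⟨l, rfl⟩ : ∃ l', l = l' + 1 := ⟨l - 1, by omega⟩
    rw [Finset.sum_range_succ]
    have := Nat.geomSum_lt (m := m) (n := l) (s := Finset.range l) (by omega)
      (fun k hk => by simpa using hk)
    simp only [Nat.add_sub_cancel] at hNdef
    omega
  have h3 : (((Finset.range m).filter (Mixed f l m X)).biUnion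
        fun b => (Finset.Ico (b * N) (b * N + N)).image (f l)).card ≤ (l - 1) * N := by
    refine (Finset.card_biUnion_le_card_mul _ _ N fun b _ =>
      Finset.card_image_le.trans (by simp)).trans ?_
    exact Nat.mul_le_mul_right _ (by omega)
  have h4 : X.toFinset.card = X.ncard := (Set.ncard_eq_toFinset_card' X).symm
  have h5 : m * N ≤ 3 * (l + 1) * N := by
    have : (l - 1) * N + 2 * N = (l + 1) * N := by rw [← add_mul]; congr 1; omega
    rw [← hml, mul_assoc]
    omega
  exact absurd (Nat.le_of_mul_le_mul_right h5 hN) (by omega)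

/-- The step that eliminates the edge of a bad layer `i`. Neighbours of `f l q` on the last layer
are in its block, hence in `X`. Its neighbours in earlier layers are `f i p` and descendants of `p`;
in a layer `j` where the descendants of `b` are all in `X` these too are in `X`, and none lies in a
layer `j < i`. -/
theorem not_adj_of_pure (h : IsWheelModel G f l m) (hm : 0 < m) {X : Set V} {b : ℕ}
    (hX : Pure f m X b l) {i p q : ℕ} (hi1 : 1 ≤ i) (hil : i < l)
    (hpb : p / m ^ (i - 1) = b) (hq : q < m ^ l) (hqp : q / m ^ (l - i) = p) (h0 : 0 < q % m)
    (h1 : q % m + 1 < m)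
    (hdeep : ∀ j < l, ∀ q' < m ^ j, G.Adj (f l q) (f j q') →
      (j = i ∧ q' = p) ∨ (i < j ∧ q' / m ^ (j - i) = p))
    {j q' : ℕ} (hj : 1 ≤ j) (hjl : j ≤ l) (hq' : q' < m ^ j) (hy : f j q' ∉ X)
    (hji : j < i ∨ Pure f m X b j) : ¬ G.Adj (f l q) (f j q') := by
  intro hadj
  have hdiv : ∀ j, i ≤ j → ∀ q', q' / m ^ (j - i) = p → q' / m ^ (j - 1) = b := by
    intro j hj q' hq'
    rw [← hpb, ← hq', Nat.div_div_eq_div_mul, ← pow_add]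
    congr 2
    omega
  rcases hjl.lt_or_eq with hjl | rfl
  · rcases hdeep j hjl q' hq' hadj with ⟨rfl, rfl⟩ | ⟨hij, hp⟩
    · rcases hji with hji | hji
      · exact absurd hji (lt_irrefl _)
      · exact hy (hji _ hq' hpb)
    · rcases hji with hji | hji
      · omega
      · exact hy (hji _ hq' (hdiv j hij.le q' hp))
  · refine hy (hX q' hq' ?_)
    -- The residue of `q` is neither `0` nor `m - 1`, so a step along the path stays in the same
    -- domain.
    have hqq : q' / m = q / m := by
      have e1 := Nat.div_add_mod q m
      rw [Nat.div_eq_iff hm]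
      rw [mul_comm] at e1
      rcases (h.adj_iff j le_rfl q hq q' hq').1 hadj with h' | h' <;> omega
    rw [← hdiv j hil.le q hqp]
    have : j - 1 = 1 + (j - 2) := by omega
    rw [this, pow_add, pow_one, ← Nat.div_div_eq_div_mul, ← Nat.div_div_eq_div_mul, hqq]

/-- If the cut-rank were below `l`, there would be pure blocks on both sides. One crossing edge is
then taken from each of the layers `1, …, l`, and all `l` of them count towards the cut-rank. -/
theorem le_cutRank [Fintype V] (h : IsWheelModel G f l m) (hl : 1 ≤ l) (hm : 3 * (l + 1) < m)
    (X : Set V) (hX : Fintype.card V ≤ 3 * X.ncard) (hXc : Fintype.card V ≤ 3 * Xᶜ.ncard) :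
    l ≤ cutRank G X := by
  classical
  by_contra! hlt
  have hm0 : 0 < m := by omega
  have hmix := (h.card_mixed_le hl hm0 X).trans_lt hlt
  obtain ⟨bX, hbX, hpX⟩ := h.exists_pure hl hm X hX hmix
  obtain ⟨bY, hbY, hpY⟩ := h.exists_pure hl hm Xᶜ hXc
    ((Finset.card_le_card (Finset.monotone_filter_right _
      (fun b _ hb => mixed_compl hb))).trans_lt hmix)
  set good : ℕ → Prop := fun i => Pure f m X bX i ∧ Pure f m Xᶜ bY i with hgood
  have key : ∀ i, ∃ r c, i ∈ Finset.Icc 1 l → r ∈ X ∧ c ∉ X ∧ G.Adj r c ∧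
      (good i → ∃ q, q + 1 < m ^ i ∧
        ((r = f i q ∧ c = f i (q + 1)) ∨ (r = f i (q + 1) ∧ c = f i q))) ∧
      (¬ good i → i < l ∧ ∃ p < m ^ i, ∃ q < m ^ l, q / m ^ (l - i) = p ∧ 0 < q % m ∧
        q % m + 1 < m ∧ (∀ j < l, ∀ q' < m ^ j, G.Adj (f l q) (f j q') →
          (j = i ∧ q' = p) ∨ (i < j ∧ q' / m ^ (j - i) = p)) ∧
        ((p / m ^ (i - 1) = bX ∧ r = f l q ∧ c = f i p) ∨
          (p / m ^ (i - 1) = bY ∧ c = f l q ∧ r = f i p))) := by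
    intro i
    by_cases hi : i ∈ Finset.Icc 1 l
    swap
    · have v := f 0 0
      exact ⟨v, v, fun hi' => absurd hi' hi⟩
    rw [Finset.mem_Icc] at hi
    by_cases hg : good i
    · have hN : 0 < m ^ (i - 1) := pow_pos hm0 _
      have hmi : m ^ i = m * m ^ (i - 1) := by rw [← pow_succ', Nat.sub_add_cancel hi.1]
      have hbd : ∀ b < m, b * m ^ (i - 1) < m ^ i := fun b hb => by
        rw [hmi]; exact Nat.mul_lt_mul_of_pos_right hb hN
      obtain ⟨q, -, hq, hqX⟩ := exists_crossing_of_ne (fun q => f i q ∈ X)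
        ⟨Nat.zero_le _, hbd bX hbX⟩ ⟨Nat.zero_le _, hbd bY hbY⟩
        (hg.1 _ (hbd bX hbX) (Nat.mul_div_cancel _ hN))
        (hg.2 _ (hbd bY hbY) (Nat.mul_div_cancel _ hN))
      obtain ⟨r, c, h1, h2, h3, h4⟩ := h.exists_oriented X hi.2 hq hqX
      exact ⟨r, c, fun _ => ⟨h1, h2, h3, fun _ => ⟨q, hq, h4⟩, fun h' => absurd hg h'⟩⟩
    · have hil : i < l := lt_of_le_of_ne hi.2 (by rintro rfl; exact hg ⟨hpX, hpY⟩)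
      have hpure : ∀ Z b, Pure f m Z b l → ∀ p q, p / m ^ (i - 1) = b → q < m ^ l →
          q / m ^ (l - i) = p → f l q ∈ Z := by
        intro Z b hZ p q hp hq hqp
        refine hZ q hq ?_
        rw [← hp, ← hqp, Nat.div_div_eq_div_mul, ← pow_add]
        congr 2
        omega
      rcases not_and_or.1 hg with hg' | hg' <;> unfold Pure at hg' <;> push Not at hg' <;>
        obtain ⟨p, hp, hpb, hpX'⟩ := hg' <;>
        obtain ⟨q, hq, hqp, h0, h1, hadj, hd⟩ := h.deep i hil p hp
      · exact ⟨f l q, f i p, fun _ => ⟨hpure X bX hpX p q hpb hq hqp, hpX', hadj,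
          fun h' => absurd h' hg, fun _ => ⟨hil, p, hp, q, hq, hqp, h0, h1, hd,
            Or.inl ⟨hpb, rfl, rfl⟩⟩⟩⟩
      · exact ⟨f i p, f l q, fun _ => ⟨not_not.1 hpX', hpure Xᶜ bY hpY p q hpb hq hqp, hadj.symm,
          fun h' => absurd h' hg, fun _ => ⟨hil, p, hp, q, hq, hqp, h0, h1, hd,
            Or.inr ⟨hpb, rfl, rfl⟩⟩⟩⟩
  choose r c hrc using key
  have hloc : ∀ j ∈ Finset.Icc 1 l, (good j ∨ j < l) ∧
      ((∃ q < m ^ j, r j = f j q) ∨ ¬ good j ∧ ∃ q < m ^ l, r j = f l q) ∧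
      ((∃ q < m ^ j, c j = f j q) ∨ ¬ good j ∧ ∃ q < m ^ l, c j = f l q) := by
    intro j hj
    obtain ⟨-, -, -, h1, h2⟩ := hrc j hj
    by_cases hg : good j
    · obtain ⟨q, hq, ⟨hr, hc⟩ | ⟨hr, hc⟩⟩ := h1 hg
      · exact ⟨Or.inl hg, Or.inl ⟨_, by omega, hr⟩, Or.inl ⟨_, hq, hc⟩⟩
      · exact ⟨Or.inl hg, Or.inl ⟨_, hq, hr⟩, Or.inl ⟨_, by omega, hc⟩⟩
    · obtain ⟨hjl, p, hp, q, hq, -, -, -, -, ⟨-, hr, hc⟩ | ⟨-, hc, hr⟩⟩ := h2 hg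
      · exact ⟨Or.inr hjl, Or.inr ⟨hg, q, hq, hr⟩, Or.inl ⟨_, hp, hc⟩⟩
      · exact ⟨Or.inr hjl, Or.inl ⟨_, hp, hr⟩, Or.inr ⟨hg, q, hq, hc⟩⟩
  have hcard := card_le_cutRank G X (Finset.Icc 1 l)
    -- The shift by `l + 1` puts all bad layers after all good ones. A bad edge can then be tested
    -- against any good layer, even a later one, where purity of that layer applies.
    (fun i => if good i then i else i + l + 1) r c ?_ (fun i hi => (hrc i hi).1)
    (fun i hi => (hrc i hi).2.1) (fun i hi => (hrc i hi).2.2.1) ?_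
  · rw [Nat.card_Icc] at hcard
    omega
  · intro i hi j hj
    rw [Finset.mem_Icc] at hi hj
    split_ifs <;> omega
  · intro i hi
    obtain ⟨-, -, -, hG, hB⟩ := hrc i hi
    have hi' := Finset.mem_Icc.1 hi
    by_cases hg : good i
    · obtain ⟨q, hq, hrc'⟩ := hG hg
      have hlow : ∀ j ∈ Finset.Icc 1 l, (if good j then j else j + l + 1) <
          (if good i then i else i + l + 1) → j < i ∧ (∃ q < m ^ j, r j = f j q) ∧
            ∃ q < m ^ j, c j = f j q := by
        intro j hj hji
        rw [if_pos hg] at hji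
        have hgj : good j := by
          by_contra hgj
          rw [if_neg hgj] at hji
          omega
        rw [if_pos hgj] at hji
        obtain ⟨-, h1, h2⟩ := hloc j hj
        exact ⟨hji, h1.resolve_right fun h => h.1 hgj, h2.resolve_right fun h => h.1 hgj⟩
      have hR : ∀ x, (∀ j < i, ∀ q' < m ^ j, ¬ G.Adj (f i x) (f j q')) → r i = f i x →
          ∀ j ∈ Finset.Icc 1 l, (if good j then j else j + l + 1) <
          (if good i then i else i + l + 1) → ¬ G.Adj (r i) (c j) := by
        intro x hx hr j hj hji
        obtain ⟨h1, -, q', hq', h3⟩ := hlow j hj hji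
        rw [hr, h3]; exact hx j h1 q' hq'
      have hC : ∀ x, (∀ j < i, ∀ q' < m ^ j, ¬ G.Adj (f i x) (f j q')) → c i = f i x →
          ∀ j ∈ Finset.Icc 1 l, (if good j then j else j + l + 1) <
          (if good i then i else i + l + 1) → ¬ G.Adj (r j) (c i) := by
        intro x hx hc j hj hji
        obtain ⟨h1, ⟨q', hq', h3⟩, -⟩ := hlow j hj hji
        rw [hc, h3]; exact fun h' => hx j h1 q' hq' h'.symm
      -- The end without ancestors may be the row or the column; it is not adjacent to any smaller
      -- layer, and all smaller keys belong to good layers above `i`.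
      rcases h.sparse i hi'.2 q hq with hs | hs <;> rcases hrc' with ⟨hr, hc⟩ | ⟨hr, hc⟩
      · exact Or.inl (hR _ hs hr)
      · exact Or.inr (hC _ hs hc)
      · exact Or.inr (hC _ hs hc)
      · exact Or.inl (hR _ hs hr)
    · obtain ⟨hil, p, hp, q, hq, hqp, h0, h1, hd, hrc'⟩ := hB hg
      have hlow : ∀ j ∈ Finset.Icc 1 l, (if good j then j else j + l + 1) <
          (if good i then i else i + l + 1) → j < i ∨ good j := by
        intro j hj hji
        rw [if_neg hg] at hji
        by_cases hgj : good j
        · exact Or.inr hgj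
        · rw [if_neg hgj] at hji
          exact Or.inl (by omega)
      -- `Z` stands for the side of the last-layer end, so that `X` and `Xᶜ` are treated alike.
      have hgen : ∀ (Z : Set V) (b : ℕ), Pure f m Z b l → p / m ^ (i - 1) = b →
          ∀ j ∈ Finset.Icc 1 l, (j < i ∨ Pure f m Z b j) → ∀ y ∉ Z,
          ((∃ q < m ^ j, y = f j q) ∨ ¬ good j ∧ ∃ q < m ^ l, y = f l q) →
          ¬ G.Adj (f l q) y := by
        intro Z b hZ hpb j hj hji y hy hyl
        have hj' := Finset.mem_Icc.1 hj
        rcases hyl with ⟨q', hq', rfl⟩ | ⟨-, q', hq', rfl⟩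
        · exact h.not_adj_of_pure hm0 hZ hi'.1 hil hpb hq hqp h0 h1 hd hj'.1 hj'.2 hq' hy hji
        · exact h.not_adj_of_pure hm0 hZ hi'.1 hil hpb hq hqp h0 h1 hd hl le_rfl hq' hy
            (Or.inr hZ)
      rcases hrc' with ⟨hpb, hr, -⟩ | ⟨hpb, hc, -⟩
      · left
        intro j hj hji
        rw [hr]
        exact hgen X bX hpX hpb j hj ((hlow j hj hji).imp id And.left) _ (hrc j hj).2.1
          (hloc j hj).2.2
      · right
        intro j hj hji
        rw [hc]
        exact fun h' => hgen Xᶜ bY hpY hpb j hj ((hlow j hj hji).imp id And.right) _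
          (not_not.2 (hrc j hj).1) (hloc j hj).2.1 h'.symm

theorem le_rankwidth [Fintype V] (h : IsWheelModel G f l m) (hl : 1 ≤ l)
    (hm : 3 * (l + 1) < m) : l ≤ rankwidth G := by
  classical
  refine Rankwidth.le_rankwidth G l ?_ fun X h1 h2 => h.le_cutRank hl hm X h1 h2
  have := Finset.card_le_univ ((Finset.range (m ^ l)).image (f l))
  rw [Finset.card_image_of_injOn (by simpa [Set.Iio] using h.injOn), Finset.card_range] at this
  have h2 : m ^ 1 ≤ m ^ l := Nat.pow_le_pow_right (by omega) hl
  rw [pow_one] at h2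
  omega

end IsWheelModel

end Rankwidth

/-! ### From uniform layered wheels to wheel models -/

namespace Layering

section Lists

variable {α : Type*}

theorem pair_infix_iff {L : List α} {x y : α} :
    [x, y] <:+: L ↔ ∃ p, L[p]? = some x ∧ L[p + 1]? = some y := by
  constructor
  · rintro ⟨s, t, rfl⟩
    refine ⟨s.length, ?_, ?_⟩ <;> simp
  · rintro ⟨p, hx, hy⟩
    obtain ⟨hp, rfl⟩ := List.getElem?_eq_some_iff.1 hx
    obtain ⟨hp', rfl⟩ := List.getElem?_eq_some_iff.1 hy
    refine ⟨L.take p, L.drop (p + 2), ?_⟩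
    conv_rhs => rw [← List.take_append_drop p L, List.drop_eq_getElem_cons hp,
      List.drop_eq_getElem_cons hp']
    simp

theorem getElem?_inj_of_nodup {L : List α} (h : L.Nodup) {p q : ℕ} {x : α}
    (hp : L[p]? = some x) (hq : L[q]? = some x) : p = q := by
  obtain ⟨hp', rfl⟩ := List.getElem?_eq_some_iff.1 hp
  obtain ⟨hq', h'⟩ := List.getElem?_eq_some_iff.1 hq
  exact (h.getElem_inj_iff.1 h').symm

theorem pair_infix_left_unique {L : List α} (h : L.Nodup) {x x' y : α} (h1 : [x, y] <:+: L)
    (h2 : [x', y] <:+: L) : x = x' := by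
  obtain ⟨p, hp, hp'⟩ := pair_infix_iff.1 h1
  obtain ⟨q, hq, hq'⟩ := pair_infix_iff.1 h2
  have := getElem?_inj_of_nodup h hp' hq'
  obtain rfl : p = q := by omega
  exact Option.some_injective _ (hp.symm.trans hq)

theorem pair_infix_right_unique {L : List α} (h : L.Nodup) {x y y' : α} (h1 : [x, y] <:+: L)
    (h2 : [x, y'] <:+: L) : y = y' := by
  obtain ⟨p, hp, hp'⟩ := pair_infix_iff.1 h1
  obtain ⟨q, hq, hq'⟩ := pair_infix_iff.1 h2
  obtain rfl := getElem?_inj_of_nodup h hp hq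
  exact Option.some_injective _ (hp'.symm.trans hq')

theorem not_pair_infix_of_last {L : List α} {x y : α} (h : (L ++ [x]).Nodup) :
    ¬ [x, y] <:+: L ++ [x] := by
  intro h1
  obtain ⟨p, hp, hp'⟩ := pair_infix_iff.1 h1
  have := getElem?_inj_of_nodup h hp (q := L.length) (by simp)
  subst this
  simp at hp'

theorem not_pair_infix_of_head {L : List α} {x y : α} (h : (y :: L).Nodup) :
    ¬ [x, y] <:+: y :: L := by
  intro h1
  obtain ⟨p, hp, hp'⟩ := pair_infix_iff.1 h1
  have := getElem?_inj_of_nodup h hp' (q := 0) (by simp)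
  omega

/-- This is how division by `m` enters: the next layer is a concatenation of domains of length `m`.
-/
theorem getElem?_flatten_of_length {LL : List (List α)} {m : ℕ} (h : ∀ s ∈ LL, s.length = m)
    {p t : ℕ} (ht : t < m) : LL.flatten[p * m + t]? = (LL[p]?).bind fun s => s[t]? := by
  induction LL generalizing p with
  | nil => simp
  | cons s LL ih =>
    have hs := h s (by simp)
    cases p with
    | zero => simp [List.getElem?_append, hs, ht]
    | succ p =>
      have := ih (fun s hs => h s (by simp [hs])) (p := p)
      rw [List.flatten_cons, List.getElem?_append_right (by rw [hs, add_mul]; omega)]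
      rw [show (p + 1) * m + t - s.length = p * m + t by rw [hs, add_mul]; omega, this]
      simp

theorem length_flatten_of_length {LL : List (List α)} {m : ℕ} (h : ∀ s ∈ LL, s.length = m) :
    LL.flatten.length = LL.length * m := by
  induction LL with
  | nil => simp
  | cons s LL ih =>
    rw [List.flatten_cons, List.length_append, ih (fun s hs => h s (by simp [hs])),
      h s (by simp), List.length_cons]
    ring

/-- The reason three marks are asked for: the middle one is not an end of the domain. -/
theorem exists_interior_of_sublist {L : List α} {a b c : α} (h : List.Sublist [a, b, c] L) :
    ∃ t, 0 < t ∧ t + 1 < L.length ∧ L[t]? = some b := by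
  obtain ⟨e, he⟩ := List.sublist_iff_exists_fin_orderEmbedding_get_eq.1 h
  have h01 : e ⟨0, by simp⟩ < e ⟨1, by simp⟩ := by simp
  have h12 : e ⟨1, by simp⟩ < e ⟨2, by simp⟩ := by simp
  refine ⟨e ⟨1, by simp⟩, by have := Fin.lt_def.1 h01; omega, ?_, ?_⟩
  · have := Fin.lt_def.1 h12
    have := (e ⟨2, by simp⟩).2
    omega
  · have := he ⟨1, by simp⟩
    simp only [List.get_eq_getElem] at this
    rw [List.getElem?_eq_getElem (e ⟨1, by simp⟩).2, ← this]
    rfl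

end Lists

variable {V : Type u} {S : Layering V} {G : SimpleGraph V} {l k m : ℕ}

/-- The parts of `c` followed by `weave L`, cut in the middle of each bridge. -/
def segments (S : Layering V) : List V → List V → List (List V)
  | _, [] => []
  | c, [x] => [c ++ S.core x]
  | c, x :: y :: t => (c ++ S.core x ++ (S.bridge x y).take ((S.bridge x y).length / 2)) ::
      segments S ((S.bridge x y).drop ((S.bridge x y).length / 2)) (y :: t)

theorem flatten_segments (c L : List V) (h : L ≠ []) :
    (S.segments c L).flatten = c ++ S.weave L := by
  induction L generalizing c with
  | nil => exact absurd rfl h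
  | cons x t ih =>
    cases t with
    | nil => simp [segments, weave]
    | cons y t =>
      rw [segments, weave, List.flatten_cons, ih _ (by simp)]
      simp only [List.append_assoc]
      rw [← List.append_assoc (List.take _ _), List.take_append_drop]

theorem length_segments (c L : List V) : (S.segments c L).length = L.length := by
  induction L generalizing c with
  | nil => rfl
  | cons x t ih =>
    cases t with
    | nil => rfl
    | cons y t => rw [segments, List.length_cons, ih, List.length_cons, List.length_cons, List.length_cons]

theorem core_sublist_segments (c L : List V) {p : ℕ} {x : V} (hx : L[p]? = some x) :
    ∃ s, (S.segments c L)[p]? = some s ∧ List.Sublist (S.core x) s := by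
  induction L generalizing c p with
  | nil => simp at hx
  | cons y t ih =>
    cases t with
    | nil =>
      cases p with
      | zero =>
        obtain rfl : y = x := by simpa using hx
        exact ⟨c ++ S.core y, by simp [segments], List.sublist_append_right _ _⟩
      | succ p => simp at hx
    | cons z t =>
      cases p with
      | zero =>
        obtain rfl : y = x := by simpa using hx
        exact ⟨_, rfl, (List.sublist_append_right _ _).trans (List.sublist_append_left _ _)⟩
      | succ p => exact ih _ (by simpa using hx)

/-- The segment of a vertex lists its domain without repetition, so uniformity gives its length. The
carry `c` is the right half of the bridge before the head of `L`, as `hc` says. -/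
theorem length_of_mem_segments {i : ℕ} (hnd : (S.layer i).Nodup)
    (hdom : ∀ v ∈ S.layer i, (S.dom i v).ncard = m) (L pre c : List V)
    (hL : S.layer i = pre ++ L)
    (hc : ∀ y ∈ L.head?, ∀ z, z ∈ c ↔
      ∃ x, [x, y] <:+: S.layer i ∧ z ∈ (S.bridge x y).drop ((S.bridge x y).length / 2))
    (hw : (c ++ S.weave L).Nodup) : ∀ s ∈ S.segments c L, s.length = m := by
  classical
  have hkey : ∀ x ∈ S.layer i, ∀ s : List V, s.Nodup → (∀ z, z ∈ s ↔ z ∈ S.dom i x) →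
      s.length = m := by
    intro x hx s hs h
    rw [← hdom x hx, ← List.toFinset_card_of_nodup hs, ← Set.ncard_coe_finset]
    congr 1
    ext z
    simpa using h z
  induction L generalizing pre c with
  | nil => simp [segments]
  | cons x t ih =>
    have hx : x ∈ S.layer i := by simp [hL]
    have hcx := hc x (by simp)
    cases t with
    | nil =>
      intro s hs
      obtain rfl : s = c ++ S.core x := by simpa [segments] using hs
      refine hkey x hx _ (by simpa [weave] using hw) fun z => ?_
      have hno : ∀ y, ¬ [x, y] <:+: S.layer i := fun y => by
        rw [hL] at hnd ⊢
        exact not_pair_infix_of_last hnd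
      simp only [dom, List.mem_append, hcx, Set.mem_ofPred_eq, hno, false_and, exists_false,
        or_false]
      exact or_comm
    | cons y t =>
      have hxy : [x, y] <:+: S.layer i := ⟨pre, t, by simp [hL]⟩
      have hw' : (c ++ S.core x ++ (S.bridge x y).take ((S.bridge x y).length / 2) ++
          ((S.bridge x y).drop ((S.bridge x y).length / 2) ++ S.weave (y :: t))).Nodup := by
        rw [← List.append_assoc, List.append_assoc _ (List.take _ _), List.take_append_drop]
        simpa only [weave, List.append_assoc] using hw
      rw [List.nodup_append'] at hw'
      intro s hs
      rw [segments, List.mem_cons] at hs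
      rcases hs with rfl | hs
      · refine hkey x hx _ hw'.1 fun z => ?_
        have hyy : (∃ y', [x, y'] <:+: S.layer i ∧
            z ∈ (S.bridge x y').take ((S.bridge x y').length / 2)) ↔
            z ∈ (S.bridge x y).take ((S.bridge x y).length / 2) := by
          constructor
          · rintro ⟨y', h1, h2⟩
            rwa [← pair_infix_right_unique hnd h1 hxy]
          · exact fun h => ⟨y, hxy, h⟩
        simp only [dom, List.mem_append, hcx, Set.mem_ofPred_eq, hyy]
        rw [or_assoc, or_left_comm]
      · refine ih (pre ++ [x]) _ (by simp [hL]) ?_ hw'.2.1 s hs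
        intro y' hy' z
        obtain rfl : y = y' := by simpa using hy'
        constructor
        · exact fun h => ⟨x, hxy, h⟩
        · rintro ⟨x', h1, h2⟩
          rwa [pair_infix_left_unique hnd hxy h1]

/-- The vertex number `q` of the layer `i`. -/
def vertexAt (S : Layering V) (r : V) (i q : ℕ) : V := (S.layer i)[q]?.getD r

namespace IsLayered

theorem exists_segments (h : S.IsLayered G l) (hu : S.IsUniform l m) {i : ℕ} (hi : i < l)
    (hne : S.layer i ≠ []) :
    S.layer (i + 1) = (S.segments [] (S.layer i)).flatten ∧
      ∀ s ∈ S.segments [] (S.layer i), s.length = m := by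
  have h1 : S.layer (i + 1) = (S.segments [] (S.layer i)).flatten := by
    rw [flatten_segments _ _ hne, List.nil_append, h.layer_succ i hi]
  refine ⟨h1, length_of_mem_segments (h.nodup i) (hu.2 i hi) _ [] _ (by simp) ?_ ?_⟩
  -- The empty carry is correct at the start: the first vertex of a layer has no left neighbour, so
  -- no bridge on its left.
  · intro y hy z
    refine ⟨by simp, ?_⟩
    rintro ⟨x, hx, -⟩
    have hnd := h.nodup i
    obtain ⟨t, ht⟩ : ∃ t, S.layer i = y :: t := by
      cases h' : S.layer i with
      | nil => exact absurd h' hne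
      | cons a t => rw [h'] at hy; simp at hy; exact ⟨t, by rw [hy]⟩
    rw [ht] at hx hnd
    exact absurd hx (not_pair_infix_of_head hnd)
  · rw [List.nil_append, ← h.layer_succ i hi]
    exact h.nodup _

theorem length_layer (h : S.IsLayered G l) (hu : S.IsUniform l m) (hm : 0 < m) {i : ℕ}
    (hi : i ≤ l) : (S.layer i).length = m ^ i := by
  induction i with
  | zero => obtain ⟨r, hr⟩ := h.layer_zero; simp [hr]
  | succ i ih =>
    have hlen := ih (by omega)
    have hne : S.layer i ≠ [] := by
      intro h'
      rw [h'] at hlen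
      have := pow_pos hm i
      simp at hlen
      omega
    obtain ⟨h1, h2⟩ := h.exists_segments hu hi hne
    rw [h1, length_flatten_of_length h2, length_segments, hlen, pow_succ]

theorem layer_ne_nil (h : S.IsLayered G l) (hu : S.IsUniform l m) (hm : 0 < m) {i : ℕ}
    (hi : i ≤ l) : S.layer i ≠ [] := by
  intro h'
  have hlen := h.length_layer hu hm hi
  rw [h'] at hlen
  have := pow_pos hm i
  simp at hlen
  omega

variable (r : V)

theorem getElem?_layer (h : S.IsLayered G l) (hu : S.IsUniform l m) (hm : 0 < m) {i q : ℕ}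
    (hi : i ≤ l) (hq : q < m ^ i) : (S.layer i)[q]? = some (S.vertexAt r i q) := by
  rw [← h.length_layer hu hm hi] at hq
  simp [vertexAt, List.getElem?_eq_getElem hq]

theorem vertexAt_mem (h : S.IsLayered G l) (hu : S.IsUniform l m) (hm : 0 < m) {i q : ℕ}
    (hi : i ≤ l) (hq : q < m ^ i) : S.vertexAt r i q ∈ S.layer i :=
  List.mem_of_getElem? (h.getElem?_layer r hu hm hi hq)

theorem exists_vertexAt (h : S.IsLayered G l) (hu : S.IsUniform l m) (hm : 0 < m) {i : ℕ} {x : V}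
    (hi : i ≤ l) (hx : x ∈ S.layer i) : ∃ q < m ^ i, S.vertexAt r i q = x := by
  obtain ⟨q, hq⟩ := List.mem_iff_getElem?.1 hx
  obtain ⟨hlt, -⟩ := List.getElem?_eq_some_iff.1 hq
  rw [h.length_layer hu hm hi] at hlt
  exact ⟨q, hlt, by simp [vertexAt, hq]⟩

theorem le_of_mem (h : S.IsLayered G l) {i : ℕ} {x : V} (hx : x ∈ S.layer i) : i ≤ l := by
  by_contra! hlt
  rw [h.layer_eq_nil i hlt] at hx
  simp at hx

theorem layer_unique (h : S.IsLayered G l) {i j : ℕ} {x : V} (hi : x ∈ S.layer i)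
    (hj : x ∈ S.layer j) : i = j :=
  (h.existsUnique_layer x).unique hi hj

theorem vertexAt_inj (h : S.IsLayered G l) (hu : S.IsUniform l m) (hm : 0 < m) {i j p q : ℕ}
    (hi : i ≤ l) (hj : j ≤ l) (hp : p < m ^ i) (hq : q < m ^ j)
    (hpq : S.vertexAt r i p = S.vertexAt r j q) : i = j ∧ p = q := by
  have hij := h.layer_unique (h.vertexAt_mem r hu hm hi hp)
    (hpq ▸ h.vertexAt_mem r hu hm hj hq)
  subst hij
  refine ⟨rfl, getElem?_inj_of_nodup (h.nodup i) (h.getElem?_layer r hu hm hi hp) ?_⟩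
  rw [hpq]
  exact h.getElem?_layer r hu hm hi hq

/-- The middle one of the three marks `A` is at an offset `t` strictly inside the segment of its
parent, hence has number `p * m + t`. -/
theorem exists_child (h : S.IsLayered G l) (hu : S.IsUniform l m) (hm : 0 < m) {i p : ℕ}
    (hi : i < l) (hp : p < m ^ i) {A : Set V}
    (hA : List.Sublist [A, A, A] (S.marks G (S.core (S.vertexAt r i p)))) :
    ∃ q < m ^ (i + 1), q / m = p ∧ 0 < q % m ∧ q % m + 1 < m ∧
      S.ancestors G (S.vertexAt r (i + 1) q) = A := by
  classical
  obtain ⟨zs, hzs, hzA⟩ := List.sublist_map_iff.1 hA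
  obtain ⟨z₁, z₂, z₃, rfl⟩ := List.length_eq_three.1
    (by simpa using (congrArg List.length hzA).symm : zs.length = 3)
  have hz : S.ancestors G z₂ = A := by simp at hzA; exact hzA.2.1.symm
  have hsub := hzs.trans List.filter_sublist
  obtain ⟨h1, h2⟩ := h.exists_segments hu hi (h.layer_ne_nil hu hm hi.le)
  obtain ⟨s, hs, hcs⟩ := core_sublist_segments (S := S) [] (S.layer i)
    (h.getElem?_layer r hu hm hi.le hp)
  have hsm := h2 s (List.mem_of_getElem? hs)
  obtain ⟨t, ht0, ht1, ht⟩ := exists_interior_of_sublist (hsub.trans hcs)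
  rw [hsm] at ht1
  have htm : t < m := by omega
  have e1 : (p * m + t) / m = p := by
    rw [Nat.div_eq_iff hm]; omega
  have e2 : (p * m + t) % m = t := by
    rw [mul_comm, Nat.mul_add_mod, Nat.mod_eq_of_lt htm]
  have hget : (S.layer (i + 1))[p * m + t]? = some z₂ := by
    rw [h1, getElem?_flatten_of_length h2 htm, hs]
    exact ht
  refine ⟨p * m + t, ?_, e1, by omega, by omega, ?_⟩
  · obtain ⟨hlt, -⟩ := List.getElem?_eq_some_iff.1 hget
    rwa [h.length_layer hu hm hi] at hlt
  · rw [vertexAt, hget]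
    exact hz

/-- If every vertex `x` has many neighbours of type 1 in its core, and many neighbours in its core
that inherit a given ancestor of `x` and have no ancestor other than this one and `x`, then every
vertex has a neighbour in each lower layer of its domain whose other ancestors are in between. -/
theorem exists_descendant (h : S.IsLayered G l) (hu : S.IsUniform l m) (hm : 0 < m)
    (hown : ∀ i < l, ∀ x ∈ S.layer i, List.Sublist [{x}, {x}, {x}] (S.marks G (S.core x)))
    (hinh : ∀ i < l, ∀ x ∈ S.layer i, ∀ v ∈ S.ancestors G x, ∃ w, (w = v ∨ w = x) ∧
      List.Sublist [{v, w}, {v, w}, {v, w}] (S.marks G (S.core x)))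
    {i p : ℕ} (hp : p < m ^ i) (d : ℕ) (hd : i + d + 1 ≤ l) :
    ∃ q < m ^ (i + d + 1), q / m ^ (d + 1) = p ∧ 0 < q % m ∧ q % m + 1 < m ∧
      S.vertexAt r i p ∈ S.ancestors G (S.vertexAt r (i + d + 1) q) ∧
      ∀ y ∈ S.ancestors G (S.vertexAt r (i + d + 1) q), y = S.vertexAt r i p ∨
        ∃ j q', i < j ∧ j ≤ l ∧ q' < m ^ j ∧ y = S.vertexAt r j q' ∧ q' / m ^ (j - i) = p := by
  induction d with
  | zero =>
    obtain ⟨q, hq, h1, h2, h3, h4⟩ := h.exists_child r hu hm (by omega) hp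
      (hown i (by omega) _ (h.vertexAt_mem r hu hm (by omega) hp))
    refine ⟨q, hq, by simpa using h1, h2, h3, by simp [h4], fun y hy => ?_⟩
    rw [add_zero, h4] at hy
    exact Or.inl hy
  | succ d ih =>
    obtain ⟨q, hq, h1, h2, h3, h4, h5⟩ := ih (by omega)
    -- The vertex found so far has the top vertex as an ancestor and passes it on. The only possible
    -- new ancestor is that vertex itself, a descendant of the top vertex in an intermediate layer.
    obtain ⟨w, hw, hvw⟩ := hinh (i + d + 1) (by omega) _ (h.vertexAt_mem r hu hm (by omega) hq) _ h4
    obtain ⟨q', hq', e1, e2, e3, e4⟩ := h.exists_child r hu hm (by omega) hq hvw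
    refine ⟨q', hq', ?_, e2, e3, ?_, fun y hy => ?_⟩
    · rw [pow_succ', ← Nat.div_div_eq_div_mul, e1, h1]
    · rw [← add_assoc, e4]; simp
    · rw [← add_assoc, e4] at hy
      rcases hy with rfl | rfl
      · exact Or.inl rfl
      · rcases hw with rfl | rfl
        · exact Or.inl rfl
        · refine Or.inr ⟨_, q, ?_, ?_, hq, rfl, ?_⟩
          · omega
          · omega
          · rw [show i + d + 1 - i = d + 1 by omega]
            exact h1

theorem isWheelModel (h : S.IsLayered G l) (hu : S.IsUniform l m) (hm : 0 < m) (hk : 4 ≤ k)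
    (hgap : ∀ w gap w', S.IsGap G w gap w' → k - 2 ≤ gap.length + 1)
    (hown : ∀ i < l, ∀ x ∈ S.layer i, List.Sublist [{x}, {x}, {x}] (S.marks G (S.core x)))
    (hinh : ∀ i < l, ∀ x ∈ S.layer i, ∀ v ∈ S.ancestors G x, ∃ w, (w = v ∨ w = x) ∧
      List.Sublist [{v, w}, {v, w}, {v, w}] (S.marks G (S.core x))) :
    Rankwidth.IsWheelModel G (S.vertexAt r) l m where
  exists_eq v := by
    obtain ⟨i, hi, -⟩ := h.existsUnique_layer v
    obtain ⟨q, hq, rfl⟩ := h.exists_vertexAt r hu hm (h.le_of_mem hi) hi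
    exact ⟨i, h.le_of_mem hi, q, hq, rfl⟩
  injOn p hp q hq hpq := (h.vertexAt_inj r hu hm le_rfl le_rfl hp hq hpq).2
  adj_iff i hi q hq q' hq' := by
    rw [h.adj_iff i _ (h.vertexAt_mem r hu hm hi hq) _ (h.vertexAt_mem r hu hm hi hq')]
    have key : ∀ a b, a < m ^ i → b < m ^ i →
        ([S.vertexAt r i a, S.vertexAt r i b] <:+: S.layer i ↔ a + 1 = b) := by
      intro a b ha hb
      rw [pair_infix_iff]
      constructor
      · rintro ⟨p, h1, h2⟩
        rw [← getElem?_inj_of_nodup (h.nodup i) h1 (h.getElem?_layer r hu hm hi ha)]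
        exact getElem?_inj_of_nodup (h.nodup i) h2 (h.getElem?_layer r hu hm hi hb)
      · rintro rfl
        exact ⟨a, h.getElem?_layer r hu hm hi ha, h.getElem?_layer r hu hm hi hb⟩
    rw [key _ _ hq hq', key _ _ hq' hq]
  sparse i hi q hq := by
    by_contra! hcon
    obtain ⟨⟨j, hj, p, hp, h1⟩, ⟨j', hj', p', hp', h2⟩⟩ := hcon
    have hq0 : q < m ^ i := by omega
    -- Two consecutive vertices with ancestors would form a gap of length 1, less than `k - 2` since
    -- `k ≥ 4`.
    have := hgap (S.vertexAt r i q) [] (S.vertexAt r i (q + 1)) ⟨⟨i, ?_⟩, ?_, ?_, by simp⟩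
    · simp at this
      omega
    · exact pair_infix_iff.2 ⟨q, h.getElem?_layer r hu hm hi hq0, h.getElem?_layer r hu hm hi hq⟩
    · exact Set.Nonempty.ne_empty ⟨_, h1, i, j, hj, h.vertexAt_mem r hu hm hi hq0,
        h.vertexAt_mem r hu hm (by omega) hp⟩
    · exact Set.Nonempty.ne_empty ⟨_, h2, i, j', hj', h.vertexAt_mem r hu hm hi hq,
        h.vertexAt_mem r hu hm (by omega) hp'⟩
  deep i hi p hp := by
    obtain ⟨d, rfl⟩ : ∃ d, l = i + d + 1 := ⟨l - i - 1, by omega⟩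
    obtain ⟨q, hq, h1, h2, h3, h4, h5⟩ := h.exists_descendant r hu hm hown hinh hp d le_rfl
    refine ⟨q, hq, by rw [show i + d + 1 - i = d + 1 by omega]; exact h1, h2, h3, h4.1, ?_⟩
    intro j hj q' hq' hadj
    rcases h5 (S.vertexAt r j q') ⟨hadj, _, j, hj, h.vertexAt_mem r hu hm le_rfl hq,
      h.vertexAt_mem r hu hm hj.le hq'⟩ with hy | ⟨j', q'', h6, h7, h8, h9, h10⟩
    · exact Or.inl (h.vertexAt_inj r hu hm hj.le hi.le hq' hp hy)
    · obtain ⟨rfl, rfl⟩ := h.vertexAt_inj r hu hm hj.le h7 hq' h8 h9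
      exact Or.inr ⟨h6, h10⟩

theorem le_rankwidth [Fintype V] (h : S.IsLayered G l) (hu : S.IsUniform l m)
    (hl : 1 ≤ l) (hm : 3 * (l + 1) < m) (hk : 4 ≤ k)
    (hgap : ∀ w gap w', S.IsGap G w gap w' → k - 2 ≤ gap.length + 1)
    (hown : ∀ i < l, ∀ x ∈ S.layer i, List.Sublist [{x}, {x}, {x}] (S.marks G (S.core x)))
    (hinh : ∀ i < l, ∀ x ∈ S.layer i, ∀ v ∈ S.ancestors G x, ∃ w, (w = v ∨ w = x) ∧
      List.Sublist [{v, w}, {v, w}, {v, w}] (S.marks G (S.core x))) :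
    l ≤ Rankwidth.rankwidth G := by
  obtain ⟨r, -⟩ := h.layer_zero
  exact (h.isWheelModel r hu (by omega) hk hgap hown hinh).le_rankwidth hl hm

theorem ancestors_eq_empty_of_mem_zero (h : S.IsLayered G l) {x : V} (hx : x ∈ S.layer 0) :
    S.ancestors G x = ∅ := by
  refine Set.eq_empty_of_forall_notMem ?_
  rintro y ⟨-, i, j, hji, hi, -⟩
  have := h.layer_unique hx hi
  omega

end IsLayered

/-! ### Types and inheritance in ttf- and ehf-layered-wheels -/

theorem mem_weave {L : List V} {z : V} (hz : z ∈ S.weave L) :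
    (∃ x ∈ L, z ∈ S.core x) ∨ ∃ x y, [x, y] <:+: L ∧ z ∈ S.bridge x y := by
  induction L with
  | nil => simp [weave] at hz
  | cons x t ih =>
    cases t with
    | nil => exact Or.inl ⟨x, by simp, by simpa [weave] using hz⟩
    | cons y t =>
      simp only [weave, List.mem_append] at hz
      rcases hz with (hz | hz) | hz
      · exact Or.inl ⟨x, by simp, hz⟩
      · exact Or.inr ⟨x, y, ⟨[], t, rfl⟩, hz⟩
      · refine (ih hz).imp ?_ ?_
        · rintro ⟨a, ha, h⟩
          exact ⟨a, List.mem_cons_of_mem _ ha, h⟩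
        · rintro ⟨a, b, hab, h⟩
          exact ⟨a, b, hab.trans (List.suffix_cons _ _).isInfix, h⟩

theorem mem_marks {L : List V} {z : V} (hz : z ∈ L) (h : S.ancestors G z ≠ ∅) :
    S.ancestors G z ∈ S.marks G L := by
  classical
  unfold marks
  exact List.mem_map_of_mem (List.mem_filter.2 ⟨hz, by simpa using h⟩)

/-- Boxes are prescribed only for vertices of type 0 and 1; by induction on layers no other types
arise, since bridges have type 0 and marks in boxes are singletons. -/
theorem IsTTFLayeredWheel.type_le_one (h : S.IsTTFLayeredWheel G l k) {i : ℕ} :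
    ∀ x ∈ S.layer i, S.ancestors G x = ∅ ∨ ∃ v, S.ancestors G x = {v} := by
  induction i with
  | zero => exact fun x hx => Or.inl (h.ancestors_eq_empty_of_mem_zero hx)
  | succ i ih =>
    intro z hz
    have hi : i < l := h.le_of_mem hz
    rw [h.layer_succ i hi] at hz
    rw [or_iff_not_imp_left]
    intro hne
    rcases mem_weave hz with ⟨x, hx, hzx⟩ | ⟨x, y, hxy, hzb⟩
    · have := mem_marks hzx hne
      rcases ih x hx with h0 | ⟨v, hv⟩
      · rw [h.box_type_zero i hi x hx h0] at this
        exact ⟨x, List.eq_of_mem_replicate this⟩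
      · rw [h.box_type_one i hi x hx v hv] at this
        simp only [List.mem_append, List.mem_replicate] at this
        rcases this with (⟨-, h'⟩ | ⟨-, h'⟩) | ⟨-, h'⟩ <;> exact ⟨_, h'⟩
    · exact absurd (h.bridge_type_zero i hi x y hxy z hzb) hne

/-- An ancestor `v` is inherited alone: the middle three marks of the box are `{v}`, so `w = v` in
the inheritance condition. -/
theorem IsTTFLayeredWheel.le_rankwidth [Fintype V] (h : S.IsTTFLayeredWheel G l k)
    (hu : S.IsUniform l m) (hl : 1 ≤ l) (hm : 3 * (l + 1) < m) (hk : 4 ≤ k) :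
    l ≤ Rankwidth.rankwidth G := by
  refine h.toIsLayered.le_rankwidth hu hl hm hk h.gap_length ?_ ?_
  · intro i hi x hx
    rcases h.type_le_one x hx with h0 | ⟨v, hv⟩
    · rw [h.box_type_zero i hi x hx h0]
      exact List.Sublist.refl _
    · rw [h.box_type_one i hi x hx v hv, List.append_assoc]
      exact List.sublist_append_left _ _
  · intro i hi x hx v hv
    rcases h.type_le_one x hx with h0 | ⟨v', hv'⟩
    · rw [h0] at hv
      exact absurd hv (Set.notMem_empty _)
    · rw [hv'] at hv
      obtain rfl : v = v' := hv
      refine ⟨v, Or.inl rfl, ?_⟩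
      rw [h.box_type_one i hi x hx v hv', Set.pair_eq_singleton]
      exact (List.sublist_append_right _ _).trans (List.sublist_append_left _ _)

theorem IsLayered.precedes_or (h : S.IsLayered G l) {v w : V} (hvw : v ≠ w) :
    S.Precedes v w ∨ S.Precedes w v := by
  obtain ⟨i, hi, -⟩ := h.existsUnique_layer v
  obtain ⟨j, hj, -⟩ := h.existsUnique_layer w
  rcases lt_trichotomy i j with hij | rfl | hij
  · exact Or.inr (Or.inl ⟨j, i, hij, hj, hi⟩)
  · obtain ⟨s, t, hst⟩ := List.append_of_mem hi
    rw [hst, List.mem_append, List.mem_cons] at hj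
    rcases hj with hj | hj | hj
    · refine Or.inr (Or.inr ⟨i, ?_⟩)
      rw [hst]
      exact List.Sublist.append (List.singleton_sublist.2 hj)
        (List.singleton_sublist.2 (by simp : v ∈ v :: t))
    · exact absurd hj.symm hvw
    · refine Or.inl (Or.inr ⟨i, ?_⟩)
      rw [hst]
      exact (List.Sublist.cons_cons v (List.singleton_sublist.2 hj)).trans
        (List.sublist_append_right _ _)
  · exact Or.inl (Or.inl ⟨i, j, hij, hi, hj⟩)

theorem IsEHFLayeredWheel.type_le_two (h : S.IsEHFLayeredWheel G l k) {i : ℕ} :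
    ∀ x ∈ S.layer i, S.ancestors G x = ∅ ∨ (∃ v, S.ancestors G x = {v}) ∨
      ∃ v w, S.Precedes v w ∧ S.ancestors G x = {v, w} := by
  -- A pair may degenerate to a singleton or be listed in the wrong order, whereas the description
  -- of the core for type 2 expects an ordered pair.
  have hpair : ∀ A : Set V, (∃ v w, A = {v, w}) → (∃ v, A = {v}) ∨
      ∃ v w, S.Precedes v w ∧ A = {v, w} := by
    rintro _ ⟨v, w, rfl⟩
    by_cases hvw : v = w
    · exact Or.inl ⟨w, by rw [hvw, Set.pair_eq_singleton]⟩
    · rcases h.precedes_or hvw with h' | h'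
      · exact Or.inr ⟨v, w, h', rfl⟩
      · exact Or.inr ⟨w, v, h', Set.pair_comm _ _⟩
  induction i with
  | zero => exact fun x hx => Or.inl (h.ancestors_eq_empty_of_mem_zero hx)
  | succ i ih =>
    intro z hz
    have hi : i < l := h.le_of_mem hz
    rw [h.layer_succ i hi] at hz
    rw [or_iff_not_imp_left]
    intro hne
    apply hpair
    rcases mem_weave hz with ⟨x, hx, hzx⟩ | ⟨x, y, hxy, hzb⟩
    · have := mem_marks hzx hne
      rcases ih x hx with h0 | ⟨v, hv⟩ | ⟨v, w, hvw, hA⟩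
      · rw [h.core_type_zero i hi x hx h0] at this
        exact ⟨x, x, by rw [List.eq_of_mem_replicate this, Set.pair_eq_singleton]⟩
      · rw [h.core_type_one i hi x hx v hv] at this
        simp only [List.mem_append, List.mem_replicate] at this
        rcases this with (⟨-, h'⟩ | ⟨-, h'⟩) | ⟨-, h'⟩
        · exact ⟨x, x, by rw [h', Set.pair_eq_singleton]⟩
        · exact ⟨_, _, h'⟩
        · exact ⟨x, x, by rw [h', Set.pair_eq_singleton]⟩
      · rw [h.core_type_two i hi x hx v w hvw hA] at this
        simp only [List.mem_append, List.mem_replicate] at this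
        have hxx : ∀ A : Set V, A = {x} → ∃ a b : V, A = {a, b} := fun A hA =>
          ⟨x, x, by rw [hA, Set.pair_eq_singleton]⟩
        rcases this with
          (((((((⟨-, h'⟩ | ⟨-, h'⟩) | ⟨-, h'⟩) | ⟨-, h'⟩) | ⟨-, h'⟩) | ⟨-, h'⟩) | ⟨-, h'⟩) |
            ⟨-, h'⟩) | ⟨-, h'⟩ <;> first | exact hxx _ h' | exact ⟨_, _, h'⟩
    · have := mem_marks hzb hne
      rw [h.bridge_zone i hi x y hxy] at this
      exact ⟨x, y, List.eq_of_mem_replicate this⟩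

/-- An ancestor `v` of `x` is inherited together with `x`, in the zone `O_{x,v}`, so `w = x` in the
inheritance condition. -/
theorem IsEHFLayeredWheel.le_rankwidth [Fintype V] (h : S.IsEHFLayeredWheel G l k)
    (hu : S.IsUniform l m) (hl : 1 ≤ l) (hm : 3 * (l + 1) < m) (hk : 4 ≤ k) :
    l ≤ Rankwidth.rankwidth G := by
  refine h.toIsLayered.le_rankwidth hu hl hm hk h.gap_length ?_ ?_
  · intro i hi x hx
    rcases h.type_le_two x hx with h0 | ⟨v, hv⟩ | ⟨v, w, hvw, hA⟩
    · rw [h.core_type_zero i hi x hx h0]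
      exact List.Sublist.refl _
    · rw [h.core_type_one i hi x hx v hv, List.append_assoc]
      exact List.sublist_append_left _ _
    · rw [h.core_type_two i hi x hx v w hvw hA]
      simp only [List.append_assoc]
      exact ((List.replicate_sublist_replicate ({x} : Set V)).2 (by norm_num : 3 ≤ 4)).trans
        (List.sublist_append_left _ _)
  · intro i hi x hx v hv
    rcases h.type_le_two x hx with h0 | ⟨v', hv'⟩ | ⟨v', w', hvw, hA⟩
    · rw [h0] at hv
      exact absurd hv (Set.notMem_empty _)
    · rw [hv'] at hv
      obtain rfl : v = v' := hv
      refine ⟨x, Or.inr rfl, ?_⟩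
      rw [h.core_type_one i hi x hx v hv', Set.pair_comm v x]
      exact (List.sublist_append_right _ _).trans (List.sublist_append_left _ _)
    · refine ⟨x, Or.inr rfl, ?_⟩
      rw [h.core_type_two i hi x hx v' w' hvw hA, Set.pair_comm v x]
      rw [hA] at hv
      rcases hv with rfl | rfl
      · rw [List.append_assoc, List.append_assoc, List.append_assoc, List.append_assoc]
        exact (List.sublist_append_right _ _).trans (List.sublist_append_left _ _)
      · rw [List.append_assoc, List.append_assoc]
        exact (List.sublist_append_right _ _).trans (List.sublist_append_left _ _)

end Layering

namespace Layering

/-! ## Construction of uniform layered wheels from words -/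

/-- A vertex `(i, q)` of the construction: number `q` in the layer `i`. -/
abbrev Pos := ℕ × ℕ

/-- The words that describe the ancestors of the vertices in the domain of a vertex `(i, p)`: the
part `lw i p` in the bridge on the left, the part `rw i p` in the bridge on the right and the part
`cw i p A` in the core, where `A` lists the ancestors of `(i, p)`. -/
structure Scheme where
  lw : ℕ → ℕ → List (List Pos)
  rw : ℕ → ℕ → List (List Pos)
  cw : ℕ → ℕ → List Pos → List (List Pos)

/-- Lists of ancestors of a vertex of the layer `i`. -/
def ValidAnc (m i : ℕ) (A : List Pos) : Prop :=
  A = [] ∨ (∃ a, A = [a] ∧ a.1 < i ∧ a.2 < m ^ a.1) ∨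
    ∃ a b, A = [a, b] ∧ (a.1 < i ∧ a.2 < m ^ a.1) ∧ (b.1 < i ∧ b.2 < m ^ b.1) ∧
      (b.1 < a.1 ∨ (a.1 = b.1 ∧ a.2 < b.2))

theorem ValidAnc.mem {m i : ℕ} {A : List Pos} (h : ValidAnc m i A) {a : Pos} (ha : a ∈ A) :
    a.1 < i ∧ a.2 < m ^ a.1 := by
  rcases h with rfl | ⟨b, rfl, hb⟩ | ⟨b, c, rfl, hb, hc, -⟩
  · simp at ha
  · rw [List.mem_singleton] at ha
    exact ha ▸ hb
  · simp only [List.mem_cons, List.not_mem_nil, or_false] at ha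
    rcases ha with rfl | rfl
    · exact hb
    · exact hc

namespace Scheme

variable (C : Scheme) (h l m : ℕ)

/-- The ancestors of the vertices in the domain of `(i, p)`. -/
def word (i p : ℕ) (A : List Pos) : List (List Pos) :=
  (if p = 0 then [] else C.lw i p) ++ C.cw i p A ++ (if p + 1 = m ^ i then [] else C.rw i p)

/-- The ancestors of the vertex `(i, q)`. -/
def anc : ℕ → ℕ → List Pos
  | 0, _ => []
  -- For a good scheme the word has length `m`, so the default is never reached by vertices of the
  -- construction.
  | i + 1, q => (C.word m i (q / m) (anc i (q / m))).getD (q % m) []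

/-- The conditions on words under which the construction works: half of a bridge has `h` vertices,
a domain has `m` vertices. -/
structure IsGood : Prop where
  h_pos : 0 < h
  h_le : 2 * h ≤ m
  length_lw : ∀ i p, (C.lw i p).length = h
  length_rw : ∀ i p, (C.rw i p).length = h
  length_cw : ∀ i p A, p < m ^ i → ValidAnc m i A → (C.cw i p A).length =
    m - (if p = 0 then 0 else h) - (if p + 1 = m ^ i then 0 else h)
  valid_lw : ∀ i p, p < m ^ i → p ≠ 0 → ∀ B ∈ C.lw i p, ValidAnc m (i + 1) B
  valid_rw : ∀ i p, p + 1 < m ^ i → ∀ B ∈ C.rw i p, ValidAnc m (i + 1) B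
  valid_cw : ∀ i p A, p < m ^ i → ValidAnc m i A → ∀ B ∈ C.cw i p A, ValidAnc m (i + 1) B

/-- The vertices of the construction. -/
abbrev Vertex (l m : ℕ) := {x : Pos // x.1 ≤ l ∧ x.2 < m ^ x.1}

variable {l m}

/-- The vertex `(i, q)`, and the root if there is no such vertex. -/
def vert (l m i q : ℕ) : Vertex l m :=
  if hx : i ≤ l ∧ q < m ^ i then ⟨(i, q), hx⟩ else ⟨(0, 0), by simp⟩

theorem vert_val {i q : ℕ} (hi : i ≤ l) (hq : q < m ^ i) : (vert l m i q).1 = (i, q) := by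
  simp [vert, hi, hq]

theorem vert_eq (x : Vertex l m) : vert l m x.1.1 x.1.2 = x :=
  Subtype.ext (vert_val x.2.1 x.2.2)

theorem vert_injOn {i : ℕ} (hi : i ≤ l) : Set.InjOn (vert l m i) (Set.Iio (m ^ i)) := by
  intro p hp q hq hpq
  have := congrArg Subtype.val hpq
  rw [vert_val hi hp, vert_val hi hq] at this
  exact (Prod.ext_iff.1 this).2

instance : Finite (Vertex l m) :=
  Set.Finite.to_subtype (s := {x : Pos | x.1 ≤ l ∧ x.2 < m ^ x.1})
    (((Set.finite_Iic l).biUnion fun i _ => ((Set.finite_Iio (m ^ i)).image (Prod.mk i))).subset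
      fun x hx => Set.mem_biUnion (Set.mem_Iic.2 hx.1) ⟨x.2, hx.2, rfl⟩)

variable (l m)

/-- The layering of the construction. -/
def layering : Layering (Vertex l m) where
  layer i := if i ≤ l then (List.range (m ^ i)).map (vert l m i) else []
  core x := (List.range' (x.1.2 * m + if x.1.2 = 0 then 0 else h)
    (m - (if x.1.2 = 0 then 0 else h) - (if x.1.2 + 1 = m ^ x.1.1 then 0 else h))).map
      (vert l m (x.1.1 + 1))
  -- The domains of `x` and `y` meet at number `y.1.2 * m`; the bridge extends `h` vertices to each
  -- side, with its middle edge across this border.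
  bridge x y := (List.range' (y.1.2 * m - h) (h + h)).map (vert l m (x.1.1 + 1))

/-- The graph of the construction. -/
def graph : SimpleGraph (Vertex l m) :=
  SimpleGraph.fromRel fun x y =>
    (x.1.1 = y.1.1 ∧ x.1.2 + 1 = y.1.2) ∨ y.1 ∈ C.anc m x.1.1 x.1.2

/-- The list of the ancestors of a vertex. -/
def ancOf {l m : ℕ} (x : Vertex l m) : List Pos := C.anc m x.1.1 x.1.2

/-- The vertices in a list of positions. -/
def toSet {l m : ℕ} (A : List Pos) : Set (Vertex l m) := {y | y.1 ∈ A}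

variable {C h l m}

theorem getElem?_layer {i q : ℕ} {x : Vertex l m} :
    ((layering h l m).layer i)[q]? = some x ↔ x.1 = (i, q) := by
  constructor
  · intro hx
    by_cases hi : i ≤ l
    · simp only [layering, if_pos hi] at hx
      obtain ⟨hlt, rfl⟩ := List.getElem?_eq_some_iff.1 hx
      simp only [List.length_map, List.length_range] at hlt
      simp [vert_val hi hlt]
    · simp [layering, hi] at hx
  · intro hx
    have hi : i ≤ l := by have := x.2.1; rwa [hx] at this
    have hq : q < m ^ i := by have := x.2.2; rwa [hx] at this
    simp only [layering, if_pos hi]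
    rw [List.getElem?_map, List.getElem?_range hq]
    simp only [Option.map_some, Option.some.injEq]
    exact Subtype.ext ((vert_val hi hq).trans hx.symm)

theorem mem_layer {i : ℕ} {x : Vertex l m} : x ∈ (layering h l m).layer i ↔ x.1.1 = i := by
  rw [List.mem_iff_getElem?]
  constructor
  · rintro ⟨q, hq⟩
    rw [getElem?_layer.1 hq]
  · rintro rfl
    exact ⟨x.1.2, getElem?_layer.2 rfl⟩

theorem pair_infix_layer {i : ℕ} {x y : Vertex l m} :
    [x, y] <:+: (layering h l m).layer i ↔ x.1.1 = i ∧ y.1.1 = i ∧ x.1.2 + 1 = y.1.2 := by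
  rw [pair_infix_iff]
  simp only [getElem?_layer, Prod.ext_iff]
  constructor
  · rintro ⟨p, ⟨h1, h2⟩, h3, h4⟩
    exact ⟨h1, h3, by omega⟩
  · rintro ⟨h1, h2, h3⟩
    exact ⟨x.1.2, ⟨h1, rfl⟩, h2, h3.symm⟩

theorem pairwise_layer (i : ℕ) :
    ((layering h l m).layer i).Pairwise fun x y => x.1.2 < y.1.2 := by
  rw [List.pairwise_iff_getElem]
  intro p q hp hq hpq
  have h1 := getElem?_layer.1 (List.getElem?_eq_getElem hp)
  have h2 := getElem?_layer.1 (List.getElem?_eq_getElem hq)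
  rw [h1, h2]
  exact hpq

theorem nodup_layer (i : ℕ) : ((layering h l m).layer i).Nodup :=
  (pairwise_layer i).imp fun hxy h' => by rw [h'] at hxy; exact lt_irrefl _ hxy

theorem mem_map_vert {i s n : ℕ} (hi : i ≤ l) (hs : s + n ≤ m ^ i) {x : Vertex l m} :
    x ∈ (List.range' s n).map (vert l m i) ↔ x.1.1 = i ∧ s ≤ x.1.2 ∧ x.1.2 < s + n := by
  simp only [List.mem_map, List.mem_range'_1]
  constructor
  · rintro ⟨q, ⟨h1, h2⟩, rfl⟩
    rw [vert_val hi (by omega)]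
    exact ⟨rfl, h1, h2⟩
  · rintro ⟨rfl, h1, h2⟩
    exact ⟨x.1.2, ⟨h1, h2⟩, vert_eq x⟩

/-- Cores and bridges are adjacent intervals of numbers. The induction runs over final parts of the
layer, which start after the bridge on the left of `p`; hence the offset `h` unless `p = 0`. -/
theorem weave_map_vert (hm : 2 * h ≤ m) {i : ℕ} (hi : i ≤ l) (n p : ℕ) (hp : p + n + 1 = m ^ i) :
    (layering h l m).weave ((List.range' p (n + 1)).map (vert l m i)) =
      (List.range' (p * m + if p = 0 then 0 else h)
        ((n + 1) * m - if p = 0 then 0 else h)).map (vert l m (i + 1)) := by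
  induction n generalizing p with
  | zero =>
    have hv := vert_val (m := m) hi (show p < m ^ i by omega)
    simp only [zero_add, List.range'_one, List.map_cons, List.map_nil, weave]
    simp only [layering, hv]
    rw [if_pos (show p + 1 = m ^ i by omega)]
    simp
  | succ n ih =>
    have hv := vert_val (m := m) hi (show p < m ^ i by omega)
    have hv' := vert_val (m := m) hi (show p + 1 < m ^ i by omega)
    have := ih (p + 1) (by omega)
    rw [List.range'_succ, List.map_cons] at this ⊢
    rw [List.range'_succ, List.map_cons, weave, this]
    simp only [layering, hv, hv', if_neg (Nat.succ_ne_zero p),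
      if_neg (show p + 1 ≠ m ^ i by omega)]
    rw [← List.map_append, ← List.map_append]
    congr 1
    have hs : (if p = 0 then 0 else h) ≤ h := by split_ifs <;> omega
    generalize (if p = 0 then 0 else h) = s at hs ⊢
    have e1 : (p + 1) * m = p * m + m := by ring
    have e2 : (n + 1 + 1) * m = (n + 1) * m + m := by ring
    have e3 : (n + 1) * m = n * m + m := by ring
    rw [show (p + 1) * m - h = p * m + s + (m - s - h) by omega, List.range'_append_1,
      show (p + 1) * m + h = p * m + s + (m - s - h + (h + h)) by omega, List.range'_append_1]
    congr 1
    omega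

end Scheme

end Layering

/-! ### Good schemes give uniform layerings -/

namespace Layering

namespace Scheme

variable {C : Scheme} {h l m : ℕ}

theorem mul_add_le {i p s : ℕ} (hp : p < m ^ i) (hs : s ≤ m) : p * m + s ≤ m ^ (i + 1) := by
  have : (p + 1) * m ≤ m ^ (i + 1) := by
    rw [pow_succ]; exact Nat.mul_le_mul_right _ hp
  rw [add_mul] at this
  omega

namespace IsGood

variable (hC : C.IsGood h m)

include hC

theorem m_pos : 0 < m := by
  have := hC.h_pos
  have := hC.h_le
  omega

theorem div_lt {i q : ℕ} (hq : q < m ^ (i + 1)) : q / m < m ^ i := by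
  rw [Nat.div_lt_iff_lt_mul hC.m_pos, ← pow_succ]
  exact hq

theorem length_word {i p : ℕ} {A : List Pos} (hp : p < m ^ i) (hA : ValidAnc m i A) :
    (C.word m i p A).length = m := by
  have h1 := hC.length_lw i p
  have h2 := hC.length_rw i p
  have h3 := hC.length_cw i p A hp hA
  have h4 := hC.h_le
  unfold word
  rw [List.length_append, List.length_append, h3]
  split_ifs <;> simp only [List.length_nil, h1, h2] <;> omega

theorem valid_word {i p : ℕ} {A : List Pos} (hp : p < m ^ i) (hA : ValidAnc m i A)
    {B : List Pos} (hB : B ∈ C.word m i p A) : ValidAnc m (i + 1) B := by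
  unfold word at hB
  rw [List.mem_append, List.mem_append] at hB
  rcases hB with (hB | hB) | hB
  · split_ifs at hB with hp0
    · simp at hB
    · exact hC.valid_lw i p hp hp0 B hB
  · exact hC.valid_cw i p A hp hA B hB
  · split_ifs at hB with hp0
    · simp at hB
    · exact hC.valid_rw i p (by omega) B hB

theorem valid_anc {i q : ℕ} (hq : q < m ^ i) : ValidAnc m i (C.anc m i q) := by
  induction i generalizing q with
  | zero => exact Or.inl rfl
  | succ i ih =>
    have hp := hC.div_lt hq
    have hlt : q % m < (C.word m i (q / m) (C.anc m i (q / m))).length := by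
      rw [hC.length_word hp (ih hp)]
      exact Nat.mod_lt _ hC.m_pos
    rw [anc, List.getD_eq_getElem _ _ hlt]
    exact hC.valid_word hp (ih hp) (List.getElem_mem hlt)

theorem valid_ancOf (x : Vertex l m) : ValidAnc m x.1.1 (C.ancOf x) := hC.valid_anc x.2.2

/-- Valid lists contain only vertices of strictly earlier layers, so an edge between layers comes
from the list of its lower end. -/
theorem ancestors_eq (x : Vertex l m) :
    (layering h l m).ancestors (C.graph l m) x = toSet (C.ancOf x) := by
  ext y
  simp only [ancestors, Set.mem_ofPred_eq, toSet, mem_layer, graph, SimpleGraph.fromRel_adj]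
  constructor
  · rintro ⟨⟨-, (⟨h1, -⟩ | h1) | ⟨h1, -⟩ | h1⟩, i, j, hji, rfl, rfl⟩
    · omega
    · exact h1
    · omega
    · have := ((hC.valid_ancOf y).mem h1).1
      omega
  · intro hy
    have hlt := ((hC.valid_ancOf x).mem hy).1
    exact ⟨⟨fun hxy => by rw [hxy] at hlt; exact lt_irrefl _ hlt, Or.inl (Or.inr hy)⟩,
      _, _, hlt, rfl, rfl⟩

theorem isLayered : (layering h l m).IsLayered (C.graph l m) l where
  layer_zero := ⟨vert l m 0 0, by simp [layering]⟩
  layer_succ i hi := by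
    have h1 : 0 < m ^ i := pow_pos hC.m_pos i
    have := weave_map_vert (l := l) hC.h_le hi.le (m ^ i - 1) 0 (by omega)
    rw [Nat.sub_add_cancel h1, ← List.range_eq_range'] at this
    have e1 : (layering h l m).layer i = (List.range (m ^ i)).map (vert l m i) := by
      simp only [layering, if_pos hi.le]
    have e2 : (layering h l m).layer (i + 1) = (List.range (m ^ (i + 1))).map (vert l m (i + 1)) := by
      simp only [layering, if_pos (show i + 1 ≤ l from hi)]
    rw [e1, this, e2, pow_succ]
    simp [List.range_eq_range']
  layer_eq_nil i hi := by simp [layering, not_le.2 hi]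
  nodup := nodup_layer
  existsUnique_layer v := ⟨v.1.1, mem_layer.2 rfl, fun i hi => (mem_layer.1 hi).symm⟩
  adj_iff i x hx y hy := by
    rw [mem_layer] at hx hy
    rw [pair_infix_layer, pair_infix_layer]
    simp only [graph, SimpleGraph.fromRel_adj]
    constructor
    · rintro ⟨-, (⟨-, h1⟩ | h1) | ⟨-, h1⟩ | h1⟩
      · exact Or.inl ⟨hx, hy, h1⟩
      · have := ((hC.valid_ancOf x).mem h1).1
        omega
      · exact Or.inr ⟨hy, hx, h1⟩
      · have := ((hC.valid_ancOf y).mem h1).1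
        omega
    · rintro (⟨-, -, h1⟩ | ⟨-, -, h1⟩)
      · exact ⟨fun h' => by rw [h'] at h1; omega, Or.inl (Or.inl ⟨hx.trans hy.symm, h1⟩)⟩
      · exact ⟨fun h' => by rw [h'] at h1; omega, Or.inr (Or.inl ⟨hy.trans hx.symm, h1⟩)⟩

/-- Left half-bridge, core and right half-bridge are consecutive intervals that fill `[p * m, p * m
+ m)`; a missing bridge is made up for by a longer core. -/
theorem dom_eq {i : ℕ} (hi : i < l) {v : Vertex l m} (hv : v.1.1 = i) :
    (layering h l m).dom i v =
      vert l m (i + 1) '' (Set.Ico (v.1.2 * m) (v.1.2 * m + m)) := by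
  subst hv
  have hh := hC.h_le
  have hle : v.1.2 * m + m ≤ m ^ (v.1.1 + 1) := mul_add_le v.2.2 le_rfl
  have himg : vert l m (v.1.1 + 1) '' (Set.Ico (v.1.2 * m) (v.1.2 * m + m)) =
      {z : Vertex l m | z.1.1 = v.1.1 + 1 ∧ v.1.2 * m ≤ z.1.2 ∧ z.1.2 < v.1.2 * m + m} := by
    ext z
    rw [Set.mem_ofPred_eq, ← mem_map_vert (by omega) hle]
    simp [List.mem_range'_1]
  have hL : ∀ x : Vertex l m, x.1.1 = v.1.1 → x.1.2 + 1 = v.1.2 → ∀ z,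
      z ∈ ((layering h l m).bridge x v).drop (((layering h l m).bridge x v).length / 2) ↔
        z.1.1 = v.1.1 + 1 ∧ v.1.2 * m ≤ z.1.2 ∧ z.1.2 < v.1.2 * m + h := by
    intro x hx1 hx2 z
    have : h ≤ v.1.2 * m := by
      rw [← hx2, add_mul]; omega
    simp only [layering, List.length_map, List.length_range', ← List.map_drop, List.drop_range',
      mul_one]
    rw [show v.1.2 * m - h + (h + h) / 2 = v.1.2 * m by omega, show h + h - (h + h) / 2 = h by omega,
      hx1, mem_map_vert (by omega) (by omega)]
  have hR : ∀ y : Vertex l m, v.1.2 + 1 = y.1.2 → ∀ z,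
      z ∈ ((layering h l m).bridge v y).take (((layering h l m).bridge v y).length / 2) ↔
        z.1.1 = v.1.1 + 1 ∧ v.1.2 * m + m - h ≤ z.1.2 ∧ z.1.2 < v.1.2 * m + m := by
    intro y hy2 z
    simp only [layering, List.length_map, List.length_range', ← List.map_take]
    rw [List.take_range'_of_length_ge (by omega), mem_map_vert (by omega) (by
      rw [← hy2, add_mul]; omega), ← hy2, add_mul, one_mul]
    omega
  have hleft : ∀ z, (∃ x, [x, v] <:+: (layering h l m).layer v.1.1 ∧
      z ∈ ((layering h l m).bridge x v).drop (((layering h l m).bridge x v).length / 2)) ↔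
      v.1.2 ≠ 0 ∧ z.1.1 = v.1.1 + 1 ∧ v.1.2 * m ≤ z.1.2 ∧ z.1.2 < v.1.2 * m + h := by
    intro z
    constructor
    · rintro ⟨x, hx, hz⟩
      rw [pair_infix_layer] at hx
      exact ⟨by omega, (hL x hx.1 hx.2.2 z).1 hz⟩
    · rintro ⟨h0, hz⟩
      have hv := vert_val (m := m) v.2.1 (show v.1.2 - 1 < m ^ v.1.1 by have := v.2.2; omega)
      have hx2 : (vert l m v.1.1 (v.1.2 - 1)).1.2 + 1 = v.1.2 := by rw [hv]; simp only; omega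
      have hx1 : (vert l m v.1.1 (v.1.2 - 1)).1.1 = v.1.1 := by rw [hv]
      exact ⟨_, pair_infix_layer.2 ⟨hx1, rfl, hx2⟩, (hL _ hx1 hx2 z).2 hz⟩
  have hright : ∀ z, (∃ y, [v, y] <:+: (layering h l m).layer v.1.1 ∧
      z ∈ ((layering h l m).bridge v y).take (((layering h l m).bridge v y).length / 2)) ↔
      v.1.2 + 1 ≠ m ^ v.1.1 ∧
        z.1.1 = v.1.1 + 1 ∧ v.1.2 * m + m - h ≤ z.1.2 ∧ z.1.2 < v.1.2 * m + m := by
    intro z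
    constructor
    · rintro ⟨y, hy, hz⟩
      rw [pair_infix_layer] at hy
      have := y.2.2
      rw [hy.2.1] at this
      exact ⟨by omega, (hR y hy.2.2 z).1 hz⟩
    · rintro ⟨h0, hz⟩
      have hv := vert_val (m := m) v.2.1 (show v.1.2 + 1 < m ^ v.1.1 by have := v.2.2; omega)
      have hx2 : v.1.2 + 1 = (vert l m v.1.1 (v.1.2 + 1)).1.2 := by rw [hv]
      have hx1 : (vert l m v.1.1 (v.1.2 + 1)).1.1 = v.1.1 := by rw [hv]
      exact ⟨_, pair_infix_layer.2 ⟨rfl, hx1, hx2⟩, (hR _ hx2 z).2 hz⟩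
  have hcore : ∀ z, z ∈ (layering h l m).core v ↔ z.1.1 = v.1.1 + 1 ∧
      (v.1.2 * m + if v.1.2 = 0 then 0 else h) ≤ z.1.2 ∧
      z.1.2 < v.1.2 * m + m - (if v.1.2 + 1 = m ^ v.1.1 then 0 else h) := by
    intro z
    simp only [layering]
    rw [mem_map_vert (by omega) (by split_ifs <;> omega)]
    split_ifs <;> omega
  rw [himg]
  ext z
  simp only [dom, Set.mem_ofPred_eq, hleft, hright, hcore]
  split_ifs <;> omega

theorem isUniform : (layering h l m).IsUniform l m := by
  refine ⟨fun i hi x y hxy => ?_, fun i hi v hv => ?_⟩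
  -- A bridge has `2 * h` vertices, hence odd length `2 * h - 1`.
  · have := hC.h_pos
    simp only [layering, List.length_map, List.length_range']
    exact ⟨h - 1, by omega⟩
  · rw [mem_layer] at hv
    have hle : v.1.2 * m + m ≤ m ^ (i + 1) := hv ▸ mul_add_le v.2.2 le_rfl
    rw [hC.dom_eq hi hv, Set.InjOn.ncard_image, ← Nat.card_coe_set_eq, Nat.card_eq_fintype_card,
      Fintype.card_ofFinset, Nat.card_Ico]
    · omega
    · exact (vert_injOn (by omega)).mono fun q hq => lt_of_lt_of_le hq.2 hle

/-- Converts intervals inside a domain into subwords, so that all conditions on cores, bridges and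
layers become conditions on words. -/
theorem map_anc_range' {i p s n : ℕ} (hi : i + 1 ≤ l) (hp : p < m ^ i) (hs : s + n ≤ m) :
    ((List.range' (p * m + s) n).map (vert l m (i + 1))).map C.ancOf =
      ((C.word m i p (C.anc m i p)).drop s).take n := by
  have hlen := hC.length_word hp (hC.valid_anc hp)
  have hle := mul_add_le (i := i) hp hs
  apply List.ext_getElem
  · simp [hlen]; omega
  · intro t h1 h2
    simp only [List.length_map, List.length_range'] at h1
    have e1 : (p * m + (s + t)) / m = p := by
      rw [Nat.div_eq_iff hC.m_pos]; omega
    have e2 : (p * m + (s + t)) % m = s + t := by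
      rw [mul_comm, Nat.mul_add_mod, Nat.mod_eq_of_lt (by omega)]
    simp only [List.getElem_map, List.getElem_range', one_mul, ancOf, List.getElem_take,
      List.getElem_drop]
    rw [vert_val hi (by omega), add_assoc]
    simp only [anc]
    rw [e1, e2, List.getD_eq_getElem _ _ (by omega)]

theorem map_anc_core {x : Vertex l m} (hx : x.1.1 < l) :
    ((layering h l m).core x).map C.ancOf = C.cw x.1.1 x.1.2 (C.ancOf x) := by
  have hA := hC.valid_ancOf x
  have hl := hC.length_lw x.1.1 x.1.2
  have hc := hC.length_cw _ _ _ x.2.2 hA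
  have hh := hC.h_le
  simp only [layering]
  rw [hC.map_anc_range' hx x.2.2 (by split_ifs <;> omega), word]
  change List.take _ (List.drop _ (_ ++ C.cw x.1.1 x.1.2 (C.ancOf x) ++ _)) = _
  rw [List.append_assoc, ← hc, List.drop_left', List.take_left']
  · rfl
  · split_ifs
    · rfl
    · exact hl

theorem map_anc_bridge {x y : Vertex l m} {i : ℕ} (hi : i < l)
    (hxy : [x, y] <:+: (layering h l m).layer i) :
    ((layering h l m).bridge x y).map C.ancOf = C.rw i x.1.2 ++ C.lw i y.1.2 := by
  obtain ⟨hx, hy, hxy⟩ := pair_infix_layer.1 hxy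
  have hx2 : x.1.2 < m ^ i := hx ▸ x.2.2
  have hy2 : y.1.2 < m ^ i := hy ▸ y.2.2
  have hh := hC.h_le
  have hl := hC.length_lw i y.1.2
  have hr := hC.length_rw i x.1.2
  have hwx := hC.length_word hx2 (hC.valid_anc hx2)
  simp only [layering]
  rw [← List.range'_append_1, List.map_append, List.map_append, hx]
  congr 1
  · rw [show y.1.2 * m - h = x.1.2 * m + (m - h) by rw [← hxy, add_mul]; omega,
      hC.map_anc_range' hi hx2 (by omega)]
    rw [word, if_neg (by omega : x.1.2 + 1 ≠ m ^ i)] at hwx ⊢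
    rw [List.length_append, hr] at hwx
    rw [List.drop_left' (by omega), List.take_of_length_le (by omega)]
  · have : h ≤ y.1.2 * m := by rw [← hxy, add_mul]; omega
    rw [show y.1.2 * m - h + h = y.1.2 * m + 0 by omega, hC.map_anc_range' hi hy2 (by omega), word,
      if_neg (by omega : y.1.2 ≠ 0), List.drop_zero, List.append_assoc, List.take_left' hl]

theorem map_anc_layer {i : ℕ} (hi : i < l) :
    ((layering h l m).layer (i + 1)).map C.ancOf =
      (List.range (m ^ i)).flatMap fun p => C.word m i p (C.anc m i p) := by
  have key : ∀ n ≤ m ^ i, ((List.range' 0 (n * m)).map (vert l m (i + 1))).map C.ancOf =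
      (List.range n).flatMap fun p => C.word m i p (C.anc m i p) := by
    intro n hn
    induction n with
    | zero => simp
    | succ n ih =>
      have := hC.map_anc_range' (s := 0) (n := m) hi (show n < m ^ i by omega) (by omega)
      rw [add_mul, one_mul, ← List.range'_append_1, List.map_append, List.map_append, ih (by omega),
        List.range_succ, List.flatMap_append, zero_add, ← add_zero (n * m), this, List.drop_zero,
        List.take_of_length_le
          (hC.length_word (show n < m ^ i by omega) (hC.valid_anc (by omega))).le]
      simp
  have := key _ le_rfl
  rw [← pow_succ, ← List.range_eq_range'] at this
  simp only [layering, if_pos (show i + 1 ≤ l from hi)]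
  exact this

end IsGood

end Scheme

end Layering

namespace Layering

/-! ## Words with unmarked and marked positions -/

section Words

variable {β : Type*}

/-- The marked positions of a word. -/
def marked (w : List (List β)) : List (List β) := w.filter fun A => !A.isEmpty

/-- A word that begins with `g` unmarked positions, followed by `n + 1` positions marked by `A` with
`a` unmarked positions between any two consecutive ones. -/
def zone (a g n : ℕ) (A : List β) : List (List β) :=
  List.replicate g [] ++ A :: (List.replicate n (List.replicate a [] ++ [A])).flatten

theorem marked_append (w w' : List (List β)) : marked (w ++ w') = marked w ++ marked w' :=
  List.filter_append ..

theorem marked_replicate_nil (n : ℕ) : marked (List.replicate n ([] : List β)) = [] := by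
  simp [marked]

theorem marked_zone (a g n : ℕ) {A : List β} (hA : A ≠ []) :
    marked (zone a g n A) = List.replicate (n + 1) A := by
  have h1 : marked (List.replicate n (List.replicate a [] ++ [A])).flatten =
      List.replicate n A := by
    induction n with
    | zero => rfl
    | succ n ih =>
      rw [List.replicate_succ, List.flatten_cons, marked_append, marked_append, ih,
        marked_replicate_nil, List.replicate_succ]
      simp [marked, hA]
  rw [zone, marked_append, marked_replicate_nil, List.nil_append, List.replicate_succ, ← h1]
  simp [marked, hA]

theorem length_zone (a g n : ℕ) (A : List β) :
    (zone a g n A).length = g + 1 + n * (a + 1) := by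
  simp [zone]
  omega

theorem mem_zone {a g n : ℕ} {A B : List β} (h : B ∈ zone a g n A) : B = [] ∨ B = A := by
  simp only [zone, List.mem_append, List.mem_replicate, List.mem_cons, List.mem_flatten] at h
  rcases h with ⟨-, rfl⟩ | rfl | ⟨w, ⟨-, rfl⟩, hw⟩
  · exact Or.inl rfl
  · exact Or.inr rfl
  · simp only [List.mem_append, List.mem_replicate, List.mem_singleton] at hw
    exact hw.imp And.right id

theorem head?_zone (a n : ℕ) (A : List β) (w : List (List β)) :
    (zone a 0 n A ++ w).head? = some A := by
  simp [zone]

theorem getLast?_zone (a g n : ℕ) (A : List β) (w : List (List β)) :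
    (w ++ zone a g n A).getLast? = some A := by
  cases n with
  | zero => simp [zone]
  | succ n =>
    have h : w ++ zone a g (n + 1) A = (w ++ (List.replicate g [] ++ A ::
        ((List.replicate n (List.replicate a [] ++ [A])).flatten ++ List.replicate a []))) ++
          [A] := by
      simp [zone, List.replicate_succ', List.flatten_append]
    rw [h, List.getLast?_concat]

/-- Any two consecutive marks `A`, `B` of a word, with `n` unmarked positions in between, satisfy
`P A B n`, where the word follows a mark `st` (none if `st = []`) and `n` unmarked positions. -/
def GapsIn (P : List β → List β → ℕ → Prop) : List β → ℕ → List (List β) → Prop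
  | _, _, [] => True
  | st, n, [] :: w => GapsIn P st (n + 1) w
  | st, n, (b :: B) :: w => (st ≠ [] → P st (b :: B) n) ∧ GapsIn P (b :: B) 0 w

variable {P : List β → List β → ℕ → Prop}

theorem gapsIn_cons {st A : List β} {n : ℕ} {w : List (List β)} (hA : A ≠ []) :
    GapsIn P st n (A :: w) ↔ (st ≠ [] → P st A n) ∧ GapsIn P A 0 w := by
  cases A with
  | nil => exact absurd rfl hA
  | cons b B => rfl

theorem gapsIn_replicate {st : List β} {n t : ℕ} {w : List (List β)} :
    GapsIn P st n (List.replicate t [] ++ w) ↔ GapsIn P st (n + t) w := by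
  induction t generalizing n with
  | zero => rfl
  | succ t ih =>
    rw [List.replicate_succ, List.cons_append, GapsIn, ih]
    congr! 1
    omega

theorem gapsIn_zone {st A : List β} {s a g n : ℕ} {w : List (List β)} (hA : A ≠ [])
    (hst : st ≠ [] → P st A (s + g)) (hn : n ≠ 0 → P A A a) (hw : GapsIn P A 0 w) :
    GapsIn P st s (zone a g n A ++ w) := by
  have key : GapsIn P A 0 ((List.replicate n (List.replicate a [] ++ [A])).flatten ++ w) := by
    induction n with
    | zero => simpa using hw
    | succ n ih =>
      rw [List.replicate_succ, List.flatten_cons, List.append_assoc, List.append_assoc,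
        gapsIn_replicate, zero_add, List.singleton_append, gapsIn_cons hA]
      exact ⟨fun _ => hn (Nat.succ_ne_zero n), ih fun _ => hn (Nat.succ_ne_zero n)⟩
  rw [zone, List.append_assoc, gapsIn_replicate, List.cons_append, gapsIn_cons hA]
  exact ⟨hst, key⟩

theorem GapsIn.of_append {A B st : List β} {s n : ℕ} {u w : List (List β)} (hA : A ≠ [])
    (hB : B ≠ []) (h : GapsIn P st s (u ++ A :: (List.replicate n [] ++ B :: w))) : P A B n := by
  induction u generalizing st s with
  | nil =>
    rw [List.nil_append, gapsIn_cons hA, gapsIn_replicate, zero_add, gapsIn_cons hB] at h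
    exact h.2.1 hA
  | cons D u ih =>
    cases D with
    | nil => exact ih (by simpa [GapsIn] using h)
    | cons b D =>
      rw [List.cons_append, gapsIn_cons (by simp)] at h
      exact ih h.2

/-- `st p` and `sn p` are the last mark before the word of `p` and the number of unmarked positions
since. Each word is checked in front of an arbitrary continuation, so the words can be treated
separately. -/
theorem gapsIn_flatMap {N : ℕ} (wd : ℕ → List (List β)) (st : ℕ → List β) (sn : ℕ → ℕ)
    (hstep : ∀ p, p + 1 < N → ∀ w, GapsIn P (st (p + 1)) (sn (p + 1)) w →
      GapsIn P (st p) (sn p) (wd p ++ w))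
    (hlast : ∀ p, p + 1 = N → GapsIn P (st p) (sn p) (wd p)) (n p : ℕ) (hp : p + n = N) :
    GapsIn P (st p) (sn p) ((List.range' p n).flatMap wd) := by
  induction n generalizing p with
  | zero => trivial
  | succ n ih =>
    rw [List.range'_succ, List.flatMap_cons]
    rcases Nat.eq_zero_or_pos n with rfl | hn
    · simpa using hlast p hp
    · exact hstep p (by omega) _ (ih (p + 1) (by omega))

end Words

/-! ### Ancestor lists and ancestor sets -/

namespace Scheme

variable {C : Scheme} {h l m : ℕ}

theorem toSet_singleton (x : Vertex l m) : toSet [x.1] = {x} := by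
  ext y
  simp [toSet, Subtype.ext_iff]

theorem toSet_pair (x y : Vertex l m) : toSet [x.1, y.1] = {x, y} := by
  ext z
  simp [toSet, Subtype.ext_iff]

theorem toSet_nil : (toSet [] : Set (Vertex l m)) = ∅ := by
  ext y
  simp [toSet]

theorem exists_vertex {i : ℕ} (hi : i ≤ l) {a : Pos} (ha : a.1 < i ∧ a.2 < m ^ a.1) :
    ∃ x : Vertex l m, x.1 = a :=
  ⟨⟨a, by omega, ha.2⟩, rfl⟩

theorem toSet_eq_empty_iff {i : ℕ} (hi : i ≤ l) {A : List Pos} (hA : ValidAnc m i A) :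
    (toSet A : Set (Vertex l m)) = ∅ ↔ A = [] := by
  refine ⟨fun h0 => ?_, fun h0 => h0 ▸ toSet_nil⟩
  rcases hA with hA | ⟨a, rfl, ha⟩ | ⟨a, b, rfl, ha, -, -⟩
  · exact hA
  · obtain ⟨x, rfl⟩ := exists_vertex hi ha
    exact absurd (h0 ▸ (by simp [toSet] : x ∈ toSet [x.1])) (Set.notMem_empty x)
  · obtain ⟨x, rfl⟩ := exists_vertex hi ha
    exact absurd (h0 ▸ (by simp [toSet] : x ∈ toSet [x.1, b])) (Set.notMem_empty x)

theorem eq_of_toSet_eq_singleton {i : ℕ} (hi : i ≤ l) {A : List Pos} (hA : ValidAnc m i A)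
    {v : Vertex l m} (h1 : toSet A = {v}) : A = [v.1] := by
  rcases hA with rfl | ⟨a, rfl, ha⟩ | ⟨a, b, rfl, ha, hb, hab⟩
  · rw [toSet_nil] at h1
    exact absurd h1.symm (Set.singleton_ne_empty v)
  · obtain ⟨x, rfl⟩ := exists_vertex hi ha
    rw [toSet_singleton, Set.singleton_eq_singleton_iff] at h1
    rw [h1]
  · obtain ⟨x, rfl⟩ := exists_vertex hi ha
    obtain ⟨y, rfl⟩ := exists_vertex hi hb
    rw [toSet_pair] at h1
    have hx : x = v := by have : x ∈ ({x, y} : Set (Vertex l m)) := by simp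
                          rwa [h1] at this
    have hy : y = v := by have : y ∈ ({x, y} : Set (Vertex l m)) := by simp
                          rwa [h1] at this
    subst hx hy
    omega

theorem lt_of_precedes {v w : Vertex l m} (hvw : (layering h l m).Precedes v w) :
    w.1.1 < v.1.1 ∨ (v.1.1 = w.1.1 ∧ v.1.2 < w.1.2) := by
  rcases hvw with ⟨i, j, hji, hv, hw⟩ | ⟨i, hi⟩
  · rw [mem_layer] at hv hw
    omega
  · refine Or.inr ⟨?_, ?_⟩
    · have hv := hi.subset (by simp : v ∈ [v, w])
      have hw := hi.subset (by simp : w ∈ [v, w])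
      rw [mem_layer] at hv hw
      omega
    · simpa using (pairwise_layer i).sublist hi

/-- The order required by `ValidAnc` is that of `Precedes`, so the set determines the list. -/
theorem eq_of_toSet_eq_pair {i : ℕ} (hi : i ≤ l) {A : List Pos} (hA : ValidAnc m i A)
    {v w : Vertex l m} (hvw : (layering h l m).Precedes v w) (h1 : toSet A = {v, w}) :
    A = [v.1, w.1] := by
  have hlt := lt_of_precedes hvw
  rcases hA with rfl | ⟨a, rfl, ha⟩ | ⟨a, b, rfl, ha, hb, hab⟩
  · rw [toSet_nil] at h1
    exact absurd (h1 ▸ (by simp : v ∈ ({v, w} : Set (Vertex l m)))) (Set.notMem_empty v)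
  · obtain ⟨x, rfl⟩ := exists_vertex hi ha
    rw [toSet_singleton] at h1
    have hx : v = x := by have : v ∈ ({v, w} : Set (Vertex l m)) := by simp
                          rwa [← h1] at this
    have hy : w = x := by have : w ∈ ({v, w} : Set (Vertex l m)) := by simp
                          rwa [← h1] at this
    subst hx hy
    omega
  · obtain ⟨x, rfl⟩ := exists_vertex hi ha
    obtain ⟨y, rfl⟩ := exists_vertex hi hb
    rw [toSet_pair, Set.pair_eq_pair_iff] at h1
    rcases h1 with ⟨rfl, rfl⟩ | ⟨rfl, rfl⟩
    · rfl
    · omega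

namespace IsGood

variable (hC : C.IsGood h m)

include hC

theorem ancestors_eq_empty_iff (x : Vertex l m) :
    (layering h l m).ancestors (C.graph l m) x = ∅ ↔ C.ancOf x = [] := by
  rw [hC.ancestors_eq, toSet_eq_empty_iff x.2.1 (hC.valid_ancOf x)]

theorem marks_eq (L : List (Vertex l m)) :
    (layering h l m).marks (C.graph l m) L = (marked (L.map C.ancOf)).map toSet := by
  classical
  rw [marks, marked, List.filter_map, List.map_map]
  have h1 : (layering h l m).ancestors (C.graph l m) = toSet ∘ C.ancOf :=
    funext fun x => hC.ancestors_eq x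
  rw [h1]
  congr 1
  refine List.filter_congr fun x _ => ?_
  have h2 := hC.ancestors_eq_empty_iff x
  rw [h1] at h2
  by_cases h3 : C.ancOf x = [] <;> simp only [Function.comp_apply] at h2 ⊢ <;>
    simp [h2, h3, toSet_nil]

theorem endsMarked {L : List (Vertex l m)} {A B : List Pos} (hA : A ≠ []) (hB : B ≠ [])
    (h1 : (L.map C.ancOf).head? = some A) (h2 : (L.map C.ancOf).getLast? = some B) :
    (layering h l m).EndsMarked (C.graph l m) L := by
  constructor
  · intro x hx
    rw [Option.mem_def] at hx
    rw [Ne, hC.ancestors_eq_empty_iff]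
    rw [List.head?_map, hx, Option.map_some, Option.some.injEq] at h1
    rwa [h1]
  · intro x hx
    rw [Option.mem_def] at hx
    rw [Ne, hC.ancestors_eq_empty_iff]
    rw [List.getLast?_map, hx, Option.map_some, Option.some.injEq] at h2
    rwa [h2]

theorem gap {P : List Pos → List Pos → ℕ → Prop}
    (hP : ∀ i < l, GapsIn P [] 0
      ((List.range (m ^ i)).flatMap fun p => C.word m i p (C.anc m i p)))
    {w w' : Vertex l m} {gap : List (Vertex l m)}
    (hg : (layering h l m).IsGap (C.graph l m) w gap w') :
    P (C.ancOf w) (C.ancOf w') gap.length := by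
  obtain ⟨⟨i, hi⟩, hw, hw', hgap⟩ := hg
  rw [Ne, hC.ancestors_eq_empty_iff] at hw hw'
  have hwi : w.1.1 = i := mem_layer.1 (hi.subset (by simp))
  cases i with
  | zero =>
    exfalso
    apply hw
    rw [ancOf, hwi, anc]
  | succ i =>
    have hil : i < l := by have := w.2.1; omega
    have h1 := hP i hil
    rw [← hC.map_anc_layer hil] at h1
    obtain ⟨s, t, hst⟩ := hi
    rw [← hst] at h1
    have h2 : gap.map C.ancOf = List.replicate gap.length [] := by
      rw [List.eq_replicate_iff]
      refine ⟨by simp, ?_⟩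
      simp only [List.mem_map]
      rintro _ ⟨x, hx, rfl⟩
      exact (hC.ancestors_eq_empty_iff x).1 (hgap x hx)
    simp only [List.map_append, List.map_cons, List.append_assoc, List.cons_append,
      h2, List.nil_append] at h1
    exact GapsIn.of_append hw hw' h1

end IsGood

end Scheme

end Layering

namespace Layering

namespace Scheme

/-- The word of length `T` of a core: `g₀` unmarked positions, three marks `[u]`, the word `t` and
`g₁` unmarked positions. -/
def coreWord (a g₀ g₁ T : ℕ) (u : Pos) (t : List (List Pos)) : List (List Pos) :=
  zone a g₀ 0 [u] ++ (zone a (T - (g₀ + g₁ + a + 3 + t.length)) 1 [u] ++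
    (t ++ List.replicate g₁ []))

theorem length_coreWord {a g₀ g₁ T : ℕ} (u : Pos) {t : List (List Pos)}
    (h : g₀ + g₁ + a + 3 + t.length ≤ T) : (coreWord a g₀ g₁ T u t).length = T := by
  simp only [coreWord, List.length_append, length_zone, List.length_replicate]
  omega

theorem mem_coreWord {a g₀ g₁ T : ℕ} {u : Pos} {t : List (List Pos)} {B : List Pos}
    (h : B ∈ coreWord a g₀ g₁ T u t) : B = [] ∨ B = [u] ∨ B ∈ t := by
  simp only [coreWord, List.mem_append, List.mem_replicate] at h
  rcases h with h | h | h | ⟨-, h⟩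
  · exact (mem_zone h).imp id Or.inl
  · exact (mem_zone h).imp id Or.inl
  · exact Or.inr (Or.inr h)
  · exact Or.inl h

theorem marked_coreWord (a g₀ g₁ T : ℕ) (u : Pos) (t : List (List Pos)) :
    marked (coreWord a g₀ g₁ T u t) = List.replicate 3 [u] ++ marked t := by
  simp only [coreWord, marked_append, marked_zone _ _ _ (List.cons_ne_nil u []),
    marked_replicate_nil, List.append_nil, ← List.append_assoc]
  rfl

theorem gapsIn_coreWord {P : List Pos → List Pos → ℕ → Prop} {a g₀ g₁ T s : ℕ} {u : Pos}
    {t w : List (List Pos)} {st : List Pos} (hst : st ≠ [] → P st [u] (s + g₀))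
    (hf : P [u] [u] (T - (g₀ + g₁ + a + 3 + t.length))) (ha : P [u] [u] a)
    (ht : ∀ w, GapsIn P [u] 0 w → GapsIn P [u] 0 (t ++ w)) (hw : GapsIn P [u] g₁ w) :
    GapsIn P st s (coreWord a g₀ g₁ T u t ++ w) := by
  have hu : [u] ≠ [] := List.cons_ne_nil u []
  rw [coreWord, List.append_assoc, List.append_assoc, List.append_assoc]
  refine gapsIn_zone hu hst (fun h => absurd rfl h) ?_
  refine gapsIn_zone hu (fun _ => by rwa [zero_add]) (fun _ => ha) ?_
  refine ht _ ?_
  rwa [gapsIn_replicate, zero_add]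

/-- The number of vertices in the core of the vertex `(i, p)`. -/
def coreSize (h m i p : ℕ) : ℕ :=
  m - (if p = 0 then 0 else h) - (if p + 1 = m ^ i then 0 else h)

theorem le_coreSize {h m i p : ℕ} : m - 2 * h ≤ coreSize h m i p := by
  unfold coreSize
  split_ifs <;> omega

/-! ### Ttf-layered-wheels -/

/-- The end of the core of a vertex `u` with ancestors `A` in a ttf-layered-wheel. -/
def ttfTail (a : ℕ) (u : Pos) : List Pos → List (List Pos)
  | [] => []
  | v :: _ => zone a a 2 [v] ++ zone a a 2 [u]

/-- The words of a uniform ttf-layered-wheel. -/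
def ttf (a h m : ℕ) : Scheme where
  lw _ _ := List.replicate h []
  rw _ _ := List.replicate h []
  cw i p A := coreWord a 0 0 (coreSize h m i p) (i, p) (ttfTail a (i, p) A)

theorem length_ttfTail_le (a : ℕ) (u : Pos) (A : List Pos) :
    (ttfTail a u A).length ≤ 6 * (a + 1) := by
  cases A with
  | nil => simp [ttfTail]
  | cons v A =>
    simp only [ttfTail, List.length_append, length_zone]
    omega

variable {a h l m k : ℕ}

theorem validAnc_self {i p : ℕ} (hp : p < m ^ i) : ValidAnc m (i + 1) [(i, p)] :=
  Or.inr (Or.inl ⟨_, rfl, Nat.lt_succ_self i, hp⟩)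

/-- A box has at most nine marks, so `9 * (a + 1)` vertices suffice for a core; `2 * h` pays for the
half-bridges. -/
theorem ttf_isGood (hh : 0 < h) (hm : 2 * h + 9 * (a + 1) ≤ m) : (ttf a h m).IsGood h m where
  h_pos := hh
  h_le := by omega
  length_lw _ _ := List.length_replicate
  length_rw _ _ := List.length_replicate
  length_cw i p A _ _ := by
    have h1 := length_ttfTail_le a (i, p) A
    have h2 := le_coreSize (h := h) (m := m) (i := i) (p := p)
    exact length_coreWord _ (by omega)
  valid_lw _ _ _ _ B hB := Or.inl (List.eq_of_mem_replicate hB)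
  valid_rw _ _ _ B hB := Or.inl (List.eq_of_mem_replicate hB)
  valid_cw i p A hp hA B hB := by
    rcases mem_coreWord hB with rfl | rfl | hB
    · exact Or.inl rfl
    · exact validAnc_self hp
    · cases A with
      | nil => simp [ttfTail] at hB
      | cons v A =>
        have hv := hA.mem (List.mem_cons_self : v ∈ v :: A)
        rw [ttfTail, List.mem_append] at hB
        rcases hB with hB | hB <;> rcases mem_zone hB with rfl | rfl
        · exact Or.inl rfl
        · exact Or.inr (Or.inl ⟨v, rfl, by omega, hv.2⟩)
        · exact Or.inl rfl
        · exact validAnc_self hp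

theorem ttf_gaps (hk : k ≤ a) (hk' : k ≤ h) (hm : 2 * h + 9 * (a + 1) ≤ m) (i : ℕ) :
    GapsIn (fun _ _ n => k - 2 ≤ n + 1) [] 0 ((List.range (m ^ i)).flatMap fun p =>
      (ttf a h m).word m i p ((ttf a h m).anc m i p)) := by
  have hcore : ∀ p A st s w, (st ≠ [] → k ≤ s) →
      GapsIn (fun _ _ n => k - 2 ≤ n + 1) [(i, p)] 0 w →
      GapsIn (fun _ _ n => k - 2 ≤ n + 1) st s ((ttf a h m).cw i p A ++ w) := by
    intro p A st s w hst hw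
    have h1 := length_ttfTail_le a (i, p) A
    have h2 := le_coreSize (h := h) (m := m) (i := i) (p := p)
    refine gapsIn_coreWord (fun h => ?_) (by omega) (by omega) (fun w hw => ?_) hw
    · have := hst h
      omega
    · cases A with
      | nil => exact hw
      | cons v A =>
        rw [ttfTail, List.append_assoc]
        exact gapsIn_zone (by simp) (fun _ => by omega) (fun _ => by omega)
          (gapsIn_zone (by simp) (fun _ => by omega) (fun _ => by omega) hw)
  have hleft : ∀ p A w, GapsIn (fun _ _ n => k - 2 ≤ n + 1) [(i, p)] 0 w →
      GapsIn (fun _ _ n => k - 2 ≤ n + 1) (if p = 0 then [] else [(i, p - 1)])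
        (if p = 0 then 0 else h)
        ((if p = 0 then [] else (ttf a h m).lw i p) ++ ((ttf a h m).cw i p A ++ w)) := by
    intro p A w hw
    split_ifs with hp
    · exact hcore p A _ _ _ (fun h => absurd rfl h) hw
    · change GapsIn _ _ _ (List.replicate h [] ++ _)
      rw [gapsIn_replicate]
      exact hcore p A _ _ _ (fun _ => by omega) hw
  rw [List.range_eq_range']
  -- Every box ends with a mark `[u]`, and the right half-bridge of `h` unmarked vertices follows.
  refine gapsIn_flatMap _ (fun p => if p = 0 then [] else [(i, p - 1)])
    (fun p => if p = 0 then 0 else h) ?_ ?_ (m ^ i) 0 (zero_add _)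
  · intro p hp w hw
    rw [word, List.append_assoc, List.append_assoc, if_neg (by omega : p + 1 ≠ m ^ i)]
    refine hleft p _ _ ?_
    change GapsIn _ _ _ (List.replicate h [] ++ _)
    rw [gapsIn_replicate]
    simpa using hw
  · intro p hp
    rw [word, if_pos hp, List.append_assoc]
    exact hleft p _ _ trivial

theorem ttf_isTTFLayeredWheel (hk : k ≤ a) (hk' : k ≤ h) (hh : 0 < h)
    (hm : 2 * h + 9 * (a + 1) ≤ m) :
    (layering h l m).IsTTFLayeredWheel ((ttf a h m).graph l m) l k := by
  have hC := ttf_isGood (a := a) hh hm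
  have hu : ∀ u : Pos, [u] ≠ [] := fun u => List.cons_ne_nil u []
  have hmarks : ∀ x : Vertex l m, x.1.1 < l →
      (layering h l m).marks ((ttf a h m).graph l m) ((layering h l m).core x) =
        (List.replicate 3 [x.1] ++ marked (ttfTail a x.1 ((ttf a h m).ancOf x))).map toSet := by
    intro x hx
    rw [hC.marks_eq, hC.map_anc_core hx]
    exact congrArg _ (marked_coreWord ..)
  refine { hC.isLayered (l := l) with
    box_ends := ?_, box_type_zero := ?_, box_type_one := ?_, bridge_type_zero := ?_,
    gap_length := ?_ }
  · intro i hi x hx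
    rw [mem_layer] at hx
    subst hx
    refine hC.endsMarked (hu x.1) (hu x.1) ?_ ?_
    · rw [hC.map_anc_core hi]
      exact head?_zone ..
    · rw [hC.map_anc_core hi]
      change (coreWord ..).getLast? = _
      rw [coreWord, List.replicate_zero, List.append_nil]
      cases (ttf a h m).ancOf x with
      | nil => rw [ttfTail, List.append_nil]; exact getLast?_zone ..
      | cons v A =>
        rw [ttfTail, ← List.append_assoc, ← List.append_assoc]
        exact getLast?_zone ..
  · intro i hi x hx h0
    rw [mem_layer] at hx
    subst hx
    rw [hmarks x hi, (hC.ancestors_eq_empty_iff x).1 h0]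
    simp [ttfTail, marked, toSet_singleton]
  · intro i hi x hx v hv
    rw [mem_layer] at hx
    subst hx
    rw [hC.ancestors_eq] at hv
    rw [hmarks x hi, eq_of_toSet_eq_singleton x.2.1 (hC.valid_ancOf x) hv, ttfTail, marked_append,
      marked_zone _ _ _ (hu _), marked_zone _ _ _ (hu _)]
    simp [toSet_singleton]
  · intro i hi x y hxy z hz
    rw [hC.ancestors_eq_empty_iff]
    have h1 : (ttf a h m).ancOf z ∈ ((layering h l m).bridge x y).map (ttf a h m).ancOf :=
      List.mem_map_of_mem hz
    rw [hC.map_anc_bridge hi hxy, List.mem_append] at h1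
    exact h1.elim List.eq_of_mem_replicate List.eq_of_mem_replicate
  · intro w gap w' hg
    exact hC.gap (P := fun _ _ n => k - 2 ≤ n + 1) (fun i _ => ttf_gaps hk hk' hm i) hg

end Scheme

end Layering

namespace Layering

namespace Scheme

/-! ### Ehf-layered-wheels -/

/-- The end of the core of a vertex `u` with ancestors `A` in an ehf-layered-wheel. -/
def ehfTail (a : ℕ) (u : Pos) : List Pos → List (List Pos)
  | [] => []
  | [v] => zone a a 2 [u, v] ++ zone a a 2 [u]
  -- The single mark completes the three of `coreWord` to the zone `E_u`. Gaps of `a + 1` unmarked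
  -- vertices occur where `u` meets `[v, w]`, with no common ancestor, and before each of these
  -- zones.
  | v :: w :: _ => zone a a 0 [u] ++ (zone a (a + 1) 3 [v, w] ++ (zone a (a + 1) 2 [u] ++
      (zone a a 2 [u, v] ++ (zone a a 2 [u] ++ (zone a a 2 [u, w] ++ (zone a a 2 [u] ++
        (zone a (a + 1) 3 [v, w] ++ zone a (a + 1) 3 [u])))))))

/-- The words of a uniform ehf-layered-wheel. -/
def ehf (a m : ℕ) : Scheme where
  -- Each half of a bridge has two of the four marks and `2 * a + 2` vertices; the `2 * a` unmarked
  -- vertices around the middle edge form one gap.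
  lw i p := zone a a 1 [(i, p - 1), (i, p)]
  rw i p := zone a 0 1 [(i, p), (i, p + 1)] ++ List.replicate a []
  -- Bridges end in marks, so a core next to one starts or stops with `a` unmarked vertices; at the
  -- ends of the layer it must itself end in a mark.
  cw i p A := coreWord a (if p = 0 then 0 else a) (if p + 1 = m ^ i then 0 else a)
    (coreSize (2 * a + 2) m i p) (i, p) (ehfTail a (i, p) A)

variable {a l m k : ℕ}

theorem length_ehfTail_le (a : ℕ) (u : Pos) (A : List Pos) :
    (ehfTail a u A).length ≤ 28 * (a + 1) + 4 := by
  rcases A with - | ⟨v, - | ⟨w, A⟩⟩ <;>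
    simp only [ehfTail, List.length_append, length_zone, List.length_nil] <;> omega

theorem even_length_ehfTail (ha : Even a) (u : Pos) (A : List Pos) :
    Even (ehfTail a u A).length := by
  obtain ⟨b, rfl⟩ := ha
  rw [Nat.even_iff]
  rcases A with - | ⟨v, - | ⟨w, A⟩⟩ <;>
    simp only [ehfTail, List.length_append, length_zone, List.length_nil] <;> omega

/-- Half-bridges take `4 * (a + 1)` vertices, the tail at most `28 * (a + 1) + 4`, and the margins
and first marks at most `3 * a + 3`; the remainder up to `40 * (a + 1)` leaves the free gap at least
`a` long. -/
theorem ehf_isGood (hm : 40 * (a + 1) ≤ m) : (ehf a m).IsGood (2 * a + 2) m where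
  h_pos := by omega
  h_le := by omega
  length_lw i p := by
    simp only [ehf, length_zone]
    omega
  length_rw i p := by
    simp only [ehf, length_zone, List.length_append, List.length_replicate]
    omega
  length_cw i p A _ _ := by
    have h1 := length_ehfTail_le a (i, p) A
    have h2 := le_coreSize (h := 2 * a + 2) (m := m) (i := i) (p := p)
    exact length_coreWord _ (by split_ifs <;> omega)
  valid_lw i p hp hp0 B hB := by
    rcases mem_zone hB with rfl | rfl
    · exact Or.inl rfl
    · exact Or.inr (Or.inr ⟨_, _, rfl, ⟨Nat.lt_succ_self i, (by omega : p - 1 < m ^ i)⟩,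
        ⟨Nat.lt_succ_self i, hp⟩, Or.inr ⟨rfl, (by omega : p - 1 < p)⟩⟩)
  valid_rw i p hp B hB := by
    change B ∈ zone a 0 1 [(i, p), (i, p + 1)] ++ List.replicate a [] at hB
    rw [List.mem_append] at hB
    rcases hB with hB | hB
    · rcases mem_zone hB with rfl | rfl
      · exact Or.inl rfl
      · exact Or.inr (Or.inr ⟨_, _, rfl, ⟨Nat.lt_succ_self i, (by omega : p < m ^ i)⟩,
          ⟨Nat.lt_succ_self i, hp⟩, Or.inr ⟨rfl, Nat.lt_succ_self p⟩⟩)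
    · exact Or.inl (List.eq_of_mem_replicate hB)
  valid_cw i p A hp hA B hB := by
    have hsub : ∀ v ∈ A, ValidAnc m (i + 1) [(i, p), v] := fun v hv => by
      obtain ⟨h1, h2⟩ := hA.mem hv
      exact Or.inr (Or.inr ⟨_, _, rfl, ⟨Nat.lt_succ_self i, hp⟩, ⟨by omega, h2⟩, Or.inl h1⟩)
    have hzone : ∀ {g n : ℕ} {D : List Pos}, ValidAnc m (i + 1) D → B ∈ zone a g n D →
        ValidAnc m (i + 1) B := fun hD hB => by
      rcases mem_zone hB with rfl | rfl
      · exact Or.inl rfl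
      · exact hD
    have hself := validAnc_self hp
    rcases mem_coreWord hB with rfl | rfl | hB
    · exact Or.inl rfl
    · exact hself
    · rcases A with - | ⟨v, - | ⟨w, A⟩⟩
      · simp [ehfTail] at hB
      · rw [ehfTail, List.mem_append] at hB
        rcases hB with hB | hB
        · exact hzone (hsub v (by simp)) hB
        · exact hzone hself hB
      · have hvw : ValidAnc m (i + 1) [v, w] := by
          rcases hA with hA | ⟨x, hA, -⟩ | ⟨x, y, hA, hx, hy, hxy⟩
          · simp at hA
          · simp at hA
          · simp only [List.cons.injEq] at hA
            obtain ⟨rfl, rfl, -⟩ := hA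
            exact Or.inr (Or.inr ⟨_, _, rfl, ⟨by omega, hx.2⟩, ⟨by omega, hy.2⟩, hxy⟩)
        simp only [ehfTail, List.mem_append] at hB
        rcases hB with hB | hB | hB | hB | hB | hB | hB | hB | hB
        · exact hzone hself hB
        · exact hzone hvw hB
        · exact hzone hself hB
        · exact hzone (hsub v (by simp)) hB
        · exact hzone hself hB
        · exact hzone (hsub w (by simp)) hB
        · exact hzone hself hB
        · exact hzone hvw hB
        · exact hzone hself hB

/-- The condition on consecutive marks `A` and `B` with `n` unmarked positions in between. -/
def EhfGap (k : ℕ) (A B : List Pos) (n : ℕ) : Prop :=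
  k - 2 ≤ n + 1 ∧ ((∃ x ∈ A, x ∈ B) → Odd (n + 1)) ∧ ((¬ ∃ x ∈ A, x ∈ B) → Even (n + 1))

theorem ehfGap_of_mem {A B : List Pos} {n : ℕ} (hk : k ≤ n) (hn : Even n) (x : Pos) (hA : x ∈ A)
    (hB : x ∈ B) : EhfGap k A B n :=
  ⟨by omega, fun _ => hn.add_one, fun h => absurd ⟨x, hA, hB⟩ h⟩

theorem ehfGap_of_disjoint {A B : List Pos} {n : ℕ} (hk : k ≤ n) (hn : Odd n)
    (h : ∀ x ∈ A, x ∉ B) : EhfGap k A B n :=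
  ⟨by omega, fun ⟨x, hA, hB⟩ => absurd hB (h x hA), fun _ => hn.add_one⟩

theorem gapsIn_ehfTail (hk : k ≤ a) (ha : Even a) {u : Pos} {A : List Pos} (hu : u ∉ A)
    {w : List (List Pos)} (hw : GapsIn (EhfGap k) [u] 0 w) :
    GapsIn (EhfGap k) [u] 0 (ehfTail a u A ++ w) := by
  have hodd : Odd (a + 1) := ha.add_one
  have hsame : ∀ (x : Pos) (B : List Pos), EhfGap k (x :: B) (x :: B) a := fun x B =>
    ehfGap_of_mem hk ha x (by simp) (by simp)
  rcases A with - | ⟨v, - | ⟨v', A⟩⟩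
  · exact hw
  · rw [ehfTail, List.append_assoc]
    refine gapsIn_zone (by simp) (fun _ => ?_) (fun _ => hsame _ _) ?_
    · rw [zero_add]; exact ehfGap_of_mem hk ha u (by simp) (by simp)
    refine gapsIn_zone (by simp) (fun _ => ?_) (fun _ => hsame _ _) hw
    rw [zero_add]; exact ehfGap_of_mem hk ha u (by simp) (by simp)
  · simp only [List.mem_cons, not_or] at hu
    have h1 : EhfGap k [u] [v, v'] (a + 1) := ehfGap_of_disjoint (by omega) hodd (by
      simp [hu.1, hu.2.1])
    have h2 : EhfGap k [v, v'] [u] (a + 1) := ehfGap_of_disjoint (by omega) hodd (by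
      simp [Ne.symm hu.1, Ne.symm hu.2.1])
    have h3 : ∀ A B : List Pos, u ∈ A → u ∈ B → EhfGap k A B a := fun A B =>
      ehfGap_of_mem hk ha u
    simp only [ehfTail, List.append_assoc]
    refine gapsIn_zone (by simp) (fun _ => ?_) (fun _ => hsame _ _) ?_
    · rw [zero_add]; exact h3 _ _ (by simp) (by simp)
    refine gapsIn_zone (by simp) (fun _ => by rwa [zero_add]) (fun _ => hsame _ _) ?_
    refine gapsIn_zone (by simp) (fun _ => by rwa [zero_add]) (fun _ => hsame _ _) ?_
    refine gapsIn_zone (by simp) (fun _ => ?_) (fun _ => hsame _ _) ?_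
    · rw [zero_add]; exact h3 _ _ (by simp) (by simp)
    refine gapsIn_zone (by simp) (fun _ => ?_) (fun _ => hsame _ _) ?_
    · rw [zero_add]; exact h3 _ _ (by simp) (by simp)
    refine gapsIn_zone (by simp) (fun _ => ?_) (fun _ => hsame _ _) ?_
    · rw [zero_add]; exact h3 _ _ (by simp) (by simp)
    refine gapsIn_zone (by simp) (fun _ => ?_) (fun _ => hsame _ _) ?_
    · rw [zero_add]; exact h3 _ _ (by simp) (by simp)
    refine gapsIn_zone (by simp) (fun _ => by rwa [zero_add]) (fun _ => hsame _ _) ?_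
    exact gapsIn_zone (by simp) (fun _ => by rwa [zero_add]) (fun _ => hsame _ _) hw

theorem ehf_gaps (hk : k ≤ a) (ha : Even a) (hm : 40 * (a + 1) ≤ m) (hmo : Odd m) (i : ℕ) :
    GapsIn (EhfGap k) [] 0 ((List.range (m ^ i)).flatMap fun p =>
      (ehf a m).word m i p ((ehf a m).anc m i p)) := by
  have hcore : ∀ p A st s w, (i, p) ∉ A →
      (st ≠ [] → EhfGap k st [(i, p)] (s + if p = 0 then 0 else a)) →
      GapsIn (EhfGap k) [(i, p)] (if p + 1 = m ^ i then 0 else a) w →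
      GapsIn (EhfGap k) st s ((ehf a m).cw i p A ++ w) := by
    intro p A st s w hA hst hw
    have h1 := length_ehfTail_le a (i, p) A
    have h2 := le_coreSize (h := 2 * a + 2) (m := m) (i := i) (p := p)
    have h3 := even_length_ehfTail ha (i, p) A
    refine gapsIn_coreWord hst (ehfGap_of_mem ?_ ?_ (i, p) (by simp) (by simp))
      (ehfGap_of_mem hk ha (i, p) (by simp) (by simp)) (fun w hw => gapsIn_ehfTail hk ha hA hw) hw
    · split_ifs <;> omega
    -- Parity of the free gap: `coreSize` is odd because `m` is odd and half-bridges are even, and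
    -- the part subtracted is odd because `a` and the tail are even. An even number of unmarked
    -- vertices gives the odd length required between two marks `[u]`.
    · unfold coreSize at h2 ⊢
      rw [Nat.even_iff] at h3 ha ⊢
      rw [Nat.odd_iff] at hmo
      split_ifs at h2 ⊢ <;> omega
  have hanc : ∀ p, p < m ^ i → (i, p) ∉ (ehf a m).anc m i p := fun p hp h' =>
    absurd (((ehf_isGood hm).valid_anc hp).mem h').1 (lt_irrefl i)
  have hleft : ∀ p A w, (i, p) ∉ A →
      GapsIn (EhfGap k) [(i, p)] (if p + 1 = m ^ i then 0 else a) w →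
      GapsIn (EhfGap k) (if p = 0 then [] else [(i, p - 1), (i, p)])
        (if p = 0 then 0 else a)
        ((if p = 0 then [] else (ehf a m).lw i p) ++ ((ehf a m).cw i p A ++ w)) := by
    intro p A w hA hw
    by_cases hp : p = 0
    · rw [if_pos hp, if_pos hp, if_pos hp, List.nil_append]
      exact hcore p A _ _ _ hA (fun h => absurd rfl h) hw
    · rw [if_neg hp, if_neg hp, if_neg hp]
      refine gapsIn_zone (by simp) (fun _ => ehfGap_of_mem (by omega) (ha.add ha) (i, p)
        (by simp) (by simp)) (fun _ => ehfGap_of_mem hk ha (i, p) (by simp) (by simp)) ?_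
      refine hcore p A _ _ _ hA (fun _ => ?_) hw
      rw [if_neg hp, zero_add]
      exact ehfGap_of_mem hk ha (i, p) (by simp) (by simp)
  rw [List.range_eq_range']
  -- For `p > 0` the word of `p` starts in the middle of a bridge, `a` unmarked vertices after the
  -- second mark of that bridge.
  refine gapsIn_flatMap _ (fun p => if p = 0 then [] else [(i, p - 1), (i, p)])
    (fun p => if p = 0 then 0 else a) ?_ ?_ (m ^ i) 0 (zero_add _)
  · intro p hp w hw
    rw [word, List.append_assoc, List.append_assoc]
    refine hleft p _ _ (hanc p (by omega)) ?_
    rw [if_neg (by omega : p + 1 ≠ m ^ i), if_neg (by omega : p + 1 ≠ m ^ i)]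
    change GapsIn _ _ _ ((zone a 0 1 [(i, p), (i, p + 1)] ++ List.replicate a []) ++ w)
    rw [List.append_assoc]
    refine gapsIn_zone (by simp) (fun _ => ehfGap_of_mem hk ha (i, p) (by simp) (by simp))
      (fun _ => ehfGap_of_mem hk ha (i, p) (by simp) (by simp)) ?_
    rw [gapsIn_replicate]
    simpa using hw
  · intro p hp
    rw [word, if_pos hp, List.append_assoc]
    exact hleft p _ _ (hanc p (by omega)) trivial

theorem exists_getLast?_ehf_coreWord (a g₀ T : ℕ) (u : Pos) (A : List Pos) :
    (coreWord a g₀ 0 T u (ehfTail a u A)).getLast? = some [u] := by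
  rw [coreWord, List.replicate_zero, List.append_nil]
  rcases A with - | ⟨v, - | ⟨w, A⟩⟩
  · rw [ehfTail, List.append_nil]
    exact getLast?_zone ..
  · simp only [ehfTail, ← List.append_assoc]
    exact getLast?_zone ..
  · simp only [ehfTail, ← List.append_assoc]
    exact getLast?_zone ..

theorem ehf_isEHFLayeredWheel (hk : k ≤ a) (ha : Even a) (hm : 40 * (a + 1) ≤ m)
    (hmo : Odd m) :
    (layering (2 * a + 2) l m).IsEHFLayeredWheel ((ehf a m).graph l m) l k := by
  have hC := ehf_isGood hm
  have hu : ∀ (u : Pos) (A : List Pos), u :: A ≠ [] := fun u A => List.cons_ne_nil u A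
  have hmarks : ∀ x : Vertex l m, x.1.1 < l →
      (layering (2 * a + 2) l m).marks ((ehf a m).graph l m) ((layering (2 * a + 2) l m).core x) =
        (List.replicate 3 [x.1] ++ marked (ehfTail a x.1 ((ehf a m).ancOf x))).map toSet := by
    intro x hx
    rw [hC.marks_eq, hC.map_anc_core hx]
    exact congrArg _ (marked_coreWord ..)
  have hbridge : ∀ i < l, ∀ x y : Vertex l m, [x, y] <:+: (layering (2 * a + 2) l m).layer i →
      ((layering (2 * a + 2) l m).bridge x y).map (ehf a m).ancOf =
        zone a 0 1 [x.1, y.1] ++ List.replicate a [] ++ zone a a 1 [x.1, y.1] := by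
    intro i hi x y hxy
    rw [hC.map_anc_bridge hi hxy]
    obtain ⟨rfl, hy, h2⟩ := pair_infix_layer.1 hxy
    have hx' : (x.1.1, y.1.2 - 1) = x.1 := Prod.ext rfl (by simp only; omega)
    have hy' : (x.1.1, y.1.2) = y.1 := Prod.ext hy.symm rfl
    simp only [ehf, h2, hx', hy', Prod.mk.eta]
  have hgap : ∀ w gap w', (layering (2 * a + 2) l m).IsGap ((ehf a m).graph l m) w gap w' →
      EhfGap k ((ehf a m).ancOf w) ((ehf a m).ancOf w') gap.length := fun w gap w' hg =>
    hC.gap (fun i _ => ehf_gaps hk ha hm hmo i) hg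
  have hinter : ∀ w w' : Vertex l m,
      ((layering (2 * a + 2) l m).ancestors ((ehf a m).graph l m) w ∩
        (layering (2 * a + 2) l m).ancestors ((ehf a m).graph l m) w').Nonempty ↔
      ∃ x ∈ (ehf a m).ancOf w, x ∈ (ehf a m).ancOf w' := by
    intro w w'
    rw [hC.ancestors_eq, hC.ancestors_eq]
    constructor
    · rintro ⟨x, h1, h2⟩
      exact ⟨x.1, h1, h2⟩
    · rintro ⟨x, h1, h2⟩
      obtain ⟨x, rfl⟩ := exists_vertex w.2.1 ((hC.valid_ancOf w).mem h1)
      exact ⟨x, h1, h2⟩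
  refine { hC.isLayered (l := l) with
    layer_ends := ?_, bridge_ends := ?_, bridge_zone := ?_, core_type_zero := ?_,
    core_type_one := ?_, core_type_two := ?_, gap_length := ?_, gap_odd := ?_, gap_even := ?_ }
  · intro i hi
    obtain ⟨N, hN⟩ : ∃ N, m ^ i = N + 1 :=
      ⟨m ^ i - 1, by have := pow_pos hC.m_pos i; omega⟩
    refine hC.endsMarked (hu (i, 0) []) (hu (i, N) []) ?_ ?_
    · rw [hC.map_anc_layer hi, hN, List.range_eq_range', List.range'_succ, List.flatMap_cons, word,
        if_pos rfl, List.nil_append, List.append_assoc]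
      change (coreWord _ _ _ _ _ _ ++ _).head? = _
      rw [coreWord, if_pos rfl, List.append_assoc]
      exact head?_zone ..
    · rw [hC.map_anc_layer hi, hN, List.range_succ, List.flatMap_append, List.flatMap_singleton,
        word, if_pos hN.symm, List.append_nil, ← List.append_assoc]
      change (_ ++ coreWord _ _ _ _ _ _).getLast? = _
      rw [if_pos hN.symm, List.getLast?_append, exists_getLast?_ehf_coreWord]
      rfl
  · intro i hi x y hxy
    refine hC.endsMarked (hu x.1 [y.1]) (hu x.1 [y.1]) ?_ ?_
    · rw [hbridge i hi x y hxy, List.append_assoc]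
      exact head?_zone ..
    · rw [hbridge i hi x y hxy]
      exact getLast?_zone ..
  · intro i hi x y hxy
    rw [hC.marks_eq, hbridge i hi x y hxy, marked_append, marked_append, marked_replicate_nil,
      marked_zone _ _ _ (hu _ _), marked_zone _ _ _ (hu _ _)]
    simp [toSet_pair]
  · intro i hi x hx h0
    rw [mem_layer] at hx
    subst hx
    rw [hmarks x hi, (hC.ancestors_eq_empty_iff x).1 h0]
    simp [ehfTail, marked, toSet_singleton]
  · intro i hi x hx v hv
    rw [mem_layer] at hx
    subst hx
    rw [hC.ancestors_eq] at hv
    rw [hmarks x hi, eq_of_toSet_eq_singleton x.2.1 (hC.valid_ancOf x) hv, ehfTail, marked_append,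
      marked_zone _ _ _ (hu _ _), marked_zone _ _ _ (hu _ _)]
    simp [toSet_singleton, toSet_pair]
  · intro i hi x hx v w hvw hA
    rw [mem_layer] at hx
    subst hx
    rw [hC.ancestors_eq] at hA
    rw [hmarks x hi, eq_of_toSet_eq_pair x.2.1 (hC.valid_ancOf x) hvw hA]
    simp only [ehfTail, marked_append, marked_zone _ _ _ (hu _ _), List.map_append,
      List.map_replicate, toSet_singleton, toSet_pair]
    rfl
  · intro w gap w' hg
    exact (hgap w gap w' hg).1
  · intro w gap w' hg h1
    exact (hgap w gap w' hg).2.1 ((hinter w w').1 h1)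
  · intro w gap w' hg h1
    exact (hgap w gap w' hg).2.2 (mt (hinter w w').2 h1)

end Scheme

end Layering

theorem mainTheorem6 (l k : ℕ) (hl : 2 ≤ l) (hk : 4 ≤ k) :
    ∃ m : ℕ,
      (∃ (V : Type) (_ : Fintype V) (G : SimpleGraph V) (S : Layering V),
        S.IsTTFLayeredWheel G l k ∧ S.IsUniform l m) ∧
      (∃ (V : Type) (_ : Fintype V) (G : SimpleGraph V) (S : Layering V),
        S.IsEHFLayeredWheel G l k ∧ S.IsUniform l m) ∧
      ∀ (V : Type u) [Fintype V] (G : SimpleGraph V) (S : Layering V),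
        S.IsTTFLayeredWheel G l k ∨ S.IsEHFLayeredWheel G l k → S.IsUniform l m →
        l ≤ Rankwidth.rankwidth G := by
  -- One odd `m` serves both families: with `a = h = k` for ttf and `a = 2 * k`, `h = 2 * a + 2` for
  -- ehf it exceeds `11 * k + 9`, `40 * (2 * k + 1)` and `3 * (l + 1)`.
  obtain ⟨m, hm⟩ : ∃ m, m = 2 * (50 * k + 50 + 3 * l) + 1 := ⟨_, rfl⟩
  have hmo : Odd m := ⟨_, hm⟩
  have ha : Even (2 * k) := even_two_mul k
  refine ⟨m, ⟨Layering.Scheme.Vertex l m, Fintype.ofFinite _, _, _,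
    Layering.Scheme.ttf_isTTFLayeredWheel (a := k) (h := k) le_rfl le_rfl (by omega) (by omega),
    (Layering.Scheme.ttf_isGood (a := k) (h := k) (by omega) (by omega)).isUniform⟩,
    ⟨Layering.Scheme.Vertex l m, Fintype.ofFinite _, _, _,
      Layering.Scheme.ehf_isEHFLayeredWheel (a := 2 * k) (by omega) ha (by omega) hmo,
      (Layering.Scheme.ehf_isGood (a := 2 * k) (by omega)).isUniform⟩, ?_⟩
  rintro V _ G S (h | h) hu
  · exact h.le_rankwidth hu (by omega) (by omega) hk
  · exact h.le_rankwidth hu (by omega) (by omega) hk
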